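/- Let $n\ge 1$, let $M$ be a real skew-symmetric $n\times n$ matrix, and let $Q$ be the ground state, i.e. the positive, radial, radially decreasing $C^2$ function in $H^1(\mathbb R^n)$ solving $-Q=-\Delta Q-Q^{1+4/n}$ on $\mathbb R^n$. Write $\Sigma=\{f\in L^2(\mathbb R^n):\nabla f,\ xf\in L^2\}$ with norm $\|f\|_2+\|\nabla f\|_2+\|xf\|_2$. Consider the mass-critical NLS $$i\varphi_t=-\Delta\varphi-|\varphi|^{4/n}\varphi$$ and the rotational NLS with repulsive harmonic potential (RNLS) $$iu_t=-\Delta u-\gamma^2|x|^2u-|u|^{4/n}u+i\,(Mx)\cdot\nabla u .$$ Let $\mathcal T>0$, $x_0\in\mathbb R^n$ and $\gamma\le-\frac1{2\mathcal T}$. Put, for $t<\mathcal T$, $$\varphi(t,x)=\frac1{(\mathcal T-t)^{n/2}}\,e^{-\frac{i|x|^2}{4(\mathcal T-t)}}\,e^{\frac{i}{\mathcal T-t}}\,Q\!\left(\frac{x}{\mathcal T-t}-x_0\right)$$ and, for $t\in\mathbb R$, $$u(t,x)=\mathcal R_\gamma\varphi(t,x)=\frac1{\cosh^{n/2}(2\gamma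 t)}\,e^{i\frac\gamma2|x|^2\tanh(2\gamma t)}\,\varphi\!\left(\frac{\tanh(2\gamma t)}{2\gamma},\frac{e^{tM}x}{\cosh(2\gamma t)}\right).$$ Then: 1. $\varphi$ is a minimal-mass blowup solution of NLS with blowup time $\mathcal T$: it is a classical ($C^2$ in $(t,x)$) solution in $C((-\infty,\mathcal T),\Sigma)$, $\|\varphi(t)\|_2=\|Q\|_2$ for all $t<\mathcal T$, and $\|\nabla\varphi(t)\|_2\to\infty$ as $t\to\mathcal T^-$. 2. $u$ is a global solution of RNLS: it is a classical ($C^2$ in $(t,x)$) solution in $C(\mathbb R,\Sigma)$. 3. $u$ blows up forward at infinite time, at an exact exponential rate: $\|\nabla u(t)\|_2\to\infty$ and $\|\nabla u(t)\|_2=O(e^{2|\gamma|t})$ as $t\to+\infty$, and also $e^{2|\gamma|t}=O(\|\nabla u(t)\|_2)$ as $t\to+\infty$. -/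

import Mathlib

open MeasureTheory Filter Set Asymptotics
open scoped Topology

noncomputable section

/-- Euclidean space `ℝⁿ`. -/
abbrev Rn (n : ℕ) : Type := EuclideanSpace ℝ (Fin n)

/-- The action `x ↦ M x` of a real `n × n` matrix on `ℝⁿ`. -/
def matAct {n : ℕ} (M : Matrix (Fin n) (Fin n) ℝ) (x : Rn n) : Rn n :=
  WithLp.toLp 2 (M.mulVec x.ofLp)

/-- The complex gradient `∇f = (∂₁f, …, ∂ₙf)` of a complex function on `ℝⁿ`, with values in `ℂⁿ`
with its Hermitian norm `|∇f|² = ∑ⱼ |∂ⱼf|²`. -/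
def cgrad {n : ℕ} (f : Rn n → ℂ) (x : Rn n) : EuclideanSpace ℂ (Fin n) :=
  WithLp.toLp 2 (fun j => fderiv ℝ f x (EuclideanSpace.single j 1))

/-- `‖∇f‖₂` as a real number (meaningful as soon as `∇f ∈ L²`). -/
def gradNorm {n : ℕ} (f : Rn n → ℂ) : ℝ := (eLpNorm (cgrad f) 2 volume).toReal

/-- A continuously differentiable function in the weighted Sobolev space
`Σ = {f ∈ L² : ∇f ∈ L², x f ∈ L²}`. For such functions the classical gradient is the weak one. -/
structure MemSigma {n : ℕ} (f : Rn n → ℂ) : Prop where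
  contDiff : ContDiff ℝ 1 f
  memLp : MemLp f 2 volume
  memLp_grad : MemLp (cgrad f) 2 volume
  memLp_weight : MemLp (fun x => ‖x‖ • f x) 2 volume

/-- The norm `‖f‖₂ + ‖∇f‖₂ + ‖x f‖₂` of `Σ`, with values in `[0, ∞]`. -/
def sigmaNorm {n : ℕ} (f : Rn n → ℂ) : ENNReal :=
  eLpNorm f 2 volume + eLpNorm (cgrad f) 2 volume + eLpNorm (fun x => ‖x‖ • f x) 2 volume

/-- `u ∈ C(I, Σ)`. -/
def ContinuousInSigma {n : ℕ} (I : Set ℝ) (u : ℝ → Rn n → ℂ) : Prop :=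
  ∀ t ∈ I, MemSigma (u t) ∧
    Tendsto (fun s => sigmaNorm (fun x => u s x - u t x)) (𝓝[I] t) (𝓝 0)

/-- `u` is, on the open time interval `I`, a solution in `C(I, Σ)` of the mass-critical focusing
rotational Schrödinger equation
`i u_t = -Δu - γ²|x|² u - |u|^(4/n) u + i (Mx)·∇u`.
The solution is moreover classical: it is `C²` on `I × ℝⁿ`, and the equation holds pointwise. -/
structure IsSolutionRNLS {n : ℕ} (γ : ℝ) (M : Matrix (Fin n) (Fin n) ℝ) (I : Set ℝ)
    (u : ℝ → Rn n → ℂ) : Prop where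
  continuous : ContinuousInSigma I u
  contDiffOn : ContDiffOn ℝ 2 (fun z : ℝ × Rn n => u z.1 z.2) (I ×ˢ univ)
  equation : ∀ t ∈ I, ∀ x : Rn n,
    Complex.I * deriv (fun s => u s x) t =
      -(Laplacian.laplacian (u t) x) - ((γ ^ 2 * ‖x‖ ^ 2 : ℝ) : ℂ) * u t x
        - ((‖u t x‖ ^ (4 / (n : ℝ)) : ℝ) : ℂ) * u t x
        + Complex.I * fderiv ℝ (u t) x (matAct M x)

/-- Solutions in `C(I, Σ)` of the mass-critical focusing NLS `i φ_t = -Δφ - |φ|^(4/n) φ`: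
no potential and no rotation. -/
def IsSolutionNLS {n : ℕ} (I : Set ℝ) (φ : ℝ → Rn n → ℂ) : Prop :=
  IsSolutionRNLS 0 0 I φ

/-- `Q` is the ground state: a positive, radial, radially decreasing `H¹` solution of
`-Q = -ΔQ - Q^(1+4/n)` on `ℝⁿ`. -/
structure IsGroundState {n : ℕ} (Q : Rn n → ℝ) : Prop where
  contDiff : ContDiff ℝ 2 Q
  pos : ∀ x, 0 < Q x
  radial : ∀ x y, ‖x‖ = ‖y‖ → Q x = Q y
  decreasing : ∀ x y, ‖x‖ ≤ ‖y‖ → Q y ≤ Q x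
  memLp : MemLp Q 2 volume
  memLp_grad : MemLp (fderiv ℝ Q) 2 volume
  equation : ∀ x, -Q x = -(Laplacian.laplacian Q x) - Q x ^ (1 + 4 / (n : ℝ))

/-- The minimal-mass profile obtained from `Q` by the pseudo-conformal transformation: for `t < T`,
`φ(t,x) = (T-t)^(-n/2) exp(-i|x|²/(4(T-t))) exp(i/(T-t)) Q(x/(T-t) - x₀)`. -/
def minimalMass {n : ℕ} (Q : Rn n → ℝ) (T : ℝ) (x₀ : Rn n) (t : ℝ) (x : Rn n) : ℂ :=
  ((1 / (T - t) ^ ((n : ℝ) / 2) : ℝ) : ℂ)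
    * Complex.exp (-(Complex.I * ((‖x‖ ^ 2 / (4 * (T - t)) : ℝ) : ℂ)))
    * Complex.exp (Complex.I * ((1 / (T - t) : ℝ) : ℂ))
    * ((Q ((1 / (T - t)) • x - x₀) : ℝ) : ℂ)

/-- The transform
`(R_γ φ)(t,x) = cosh(2γt)^(-n/2) exp(i(γ/2)|x|² tanh(2γt)) φ(tanh(2γt)/(2γ), e^{tM}x/cosh(2γt))`. -/
def Rtransform {n : ℕ} (γ : ℝ) (M : Matrix (Fin n) (Fin n) ℝ) (φ : ℝ → Rn n → ℂ)
    (t : ℝ) (x : Rn n) : ℂ :=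
  ((1 / Real.cosh (2 * γ * t) ^ ((n : ℝ) / 2) : ℝ) : ℂ)
    * Complex.exp (Complex.I * ((γ / 2 * ‖x‖ ^ 2 * Real.tanh (2 * γ * t) : ℝ) : ℂ))
    * φ (Real.tanh (2 * γ * t) / (2 * γ))
        ((1 / Real.cosh (2 * γ * t)) • matAct (NormedSpace.exp (t • M)) x)

end

/-!
Both waves of the theorem have the form
`D^(-n/2) exp(i (θ|x|² + β)) Q(e^{tM}x / D - x₀)` with functions `D > 0`, `θ`, `β` of time
(`quadWave`). Such a wave solves RNLS with potential strength `γ` as soon as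
`D' = 4θD`, `θ' = γ² - 4θ²` and `β' = D⁻²` (`IsModulation.isSolutionRNLS`): the first equation
cancels the terms in `∇Q` and the divergence term, the second the terms in `|x|²Q`, and the third
leaves the equation of the ground state; the rotation of the argument produces `i (Mx)·∇u`, because
`Mx` is orthogonal to `x`. The profile `φ` is the case `γ = 0`, `M = 0`, `D = T - t`, and its
transform `u` the case `D = T cosh(2γt) - sinh(2γt)/(2γ)`, `θ = D'/(4D)`
(`Rtransform_minimalMass_eq_quadWave`). The hypothesis on `γ` is exactly what keeps this `D` positive
for all times.

Membership in `Σ` and continuity in time with values in `Σ` need decay of `Q` and `∇Q` at infinity.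
It comes from radial monotonicity. At `x = re` the function `Q` is maximal along every line through
`x` orthogonal to `x`, so the radial profile `g` satisfies `g'' ≥ ΔQ = (1 - g^(4/n)) g`, and `g → 0`
since `Q ∈ L²`. Hence `g'' ≥ g/4` far out, and a decreasing function with this property decays
exponentially together with its derivative (`convex_decay_rate`, `IsGroundState.exp_decay`).
Dominated convergence does the rest (`continuousInSigma_of_sigmaDecay`).

Since `Q` is real, the two parts of `∇u`, from the phase and from the modulus, are orthogonal
pointwise, and a change of variables gives (`gradNorm_quadWave_sq`)
`‖∇u‖₂² = 4θ²D² ∫ |y + x₀|² Q² + D⁻² ∫ |∇Q|²`, where both integrals are positive.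
For `φ` the second term is of size `(T - t)⁻²`. For `u` one has `4θ²D² = D'²/4`, both terms are
`O(e^{4|γ|t})`, and one of them is of that size: the second if `2|γ|T = 1`, where `D` is a multiple
of `e^{-2|γ|t}`, and the first if `2|γ|T > 1`, where `D'` is of size `e^{2|γ|t}`.
-/

/-! ### Exponential decay for a one-dimensional differential inequality -/

/-- Second-order necessary condition at a local maximum. -/
lemma second_deriv_nonpos_of_isLocalMax {h h' : ℝ → ℝ} {h2 a : ℝ}
    (hh : ∀ s, HasDerivAt h (h' s) s) (hh' : HasDerivAt h' h2 a) (hmax : IsLocalMax h a) :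
    h2 ≤ 0 := by
  by_contra! hpos
  have hd : deriv h = h' := funext fun s => (hh s).deriv
  have hmin : IsLocalMin h a :=
    isLocalMin_of_deriv_deriv_pos (by rw [hd, hh'.deriv]; exact hpos)
      hmax.deriv_eq_zero (hh a).continuousAt
  have hconst : h =ᶠ[𝓝 a] fun _ => h a := by
    filter_upwards [hmax, hmin] with s h1 h2 using le_antisymm h1 h2
  have hz : h' =ᶠ[𝓝 a] fun _ => 0 := by
    have := hconst.deriv
    rw [hd] at this
    simpa using this
  have := hz.deriv_eq
  rw [hh'.deriv] at this
  simp at this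
  linarith

/-- A positive decreasing function with `g'' ≥ c² g` near infinity decays like `exp (-c r)`, and so
does its derivative. -/
lemma convex_decay_rate {g g' g'' : ℝ → ℝ} {c R : ℝ} (hc : 0 < c) (hR : 0 < R)
    (hg : ∀ r, HasDerivAt g (g' r) r) (hg' : ∀ r, HasDerivAt g' (g'' r) r)
    (hpos : ∀ r, 0 < g r) (hanti : AntitoneOn g (Ici 0))
    (hineq : ∀ r, R ≤ r → c ^ 2 * g r ≤ g'' r) :
    ∃ C, ∀ r, 0 ≤ r → g r ≤ C * Real.exp (-(c * r)) ∧ |g' r| ≤ C * Real.exp (-(c * r)) := by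
  have hE : ∀ k r : ℝ, HasDerivAt (fun s => Real.exp (k * s)) (k * Real.exp (k * r)) r := by
    intro k r
    have := ((hasDerivAt_id r).const_mul k).exp
    simpa [mul_comm] using this
  have hneg : ∀ r, 0 < r → g' r ≤ 0 := by
    intro r hr
    rw [← (hg r).deriv, ← derivWithin_of_mem_nhds (Ici_mem_nhds hr)]
    exact hanti.derivWithin_nonpos
  have hIci : interior (Ici R) = Ioi R := interior_Ici
  -- multiplying `g' + c g` by `exp (-c r)` gives a monotone function
  have hmono : MonotoneOn (fun r => Real.exp (-c * r) * (g' r + c * g r)) (Ici R) := by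
    have hd : ∀ r, HasDerivAt (fun r => Real.exp (-c * r) * (g' r + c * g r))
        (Real.exp (-c * r) * (g'' r - c ^ 2 * g r)) r := by
      intro r
      refine ((hE (-c) r).mul ((hg' r).add ((hg r).const_mul c))).congr_deriv ?_
      simp only [Pi.add_apply]
      ring
    refine monotoneOn_of_deriv_nonneg (convex_Ici R)
      (fun r _ => (hd r).continuousAt.continuousWithinAt)
      (fun r _ => (hd r).differentiableAt.differentiableWithinAt) ?_
    intro r hr
    rw [hIci] at hr
    rw [(hd r).deriv]
    exact mul_nonneg (Real.exp_pos _).le (sub_nonneg.2 (hineq r (le_of_lt hr)))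
  have hle : ∀ r, R ≤ r → g' r + c * g r ≤ 0 := by
    intro r₀ hr₀
    by_contra! hcon
    -- otherwise `g` would grow like `exp (c r)`
    set m := Real.exp (-c * r₀) * (g' r₀ + c * g r₀) with hm
    have hm0 : 0 < m := mul_pos (Real.exp_pos _) hcon
    obtain ⟨r, hr, hbig⟩ : ∃ r, r₀ ≤ r ∧ c * g R < m * (c * r + 1) := by
      refine ⟨max r₀ (g R / m), le_max_left _ _, ?_⟩
      have h1 : g R / m ≤ max r₀ (g R / m) := le_max_right _ _
      rw [div_le_iff₀ hm0] at h1
      nlinarith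
    have h1 := hmono (show r₀ ∈ Ici R from hr₀) (show r ∈ Ici R from hr₀.trans hr) hr
    have h2 : m * Real.exp (c * r) ≤ g' r + c * g r := by
      have h3 := mul_le_mul_of_nonneg_right h1 (Real.exp_pos (c * r)).le
      have h4 : Real.exp (-c * r) * Real.exp (c * r) = 1 := by
        rw [← Real.exp_add]; simp
      calc m * Real.exp (c * r) ≤ _ := h3
        _ = (Real.exp (-c * r) * Real.exp (c * r)) * (g' r + c * g r) := by ring
        _ = _ := by rw [h4, one_mul]
    have h5 := Real.add_one_le_exp (c * r)
    have h6 := hneg r (hR.trans_le (hr₀.trans hr))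
    have h7 : g r ≤ g R := hanti hR.le (hR.le.trans (hr₀.trans hr)) (hr₀.trans hr)
    nlinarith
  have hantik : AntitoneOn (fun r => Real.exp (c * r) * g r) (Ici R) := by
    have hd : ∀ r, HasDerivAt (fun r => Real.exp (c * r) * g r)
        (Real.exp (c * r) * (g' r + c * g r)) r := by
      intro r
      refine ((hE c r).mul (hg r)).congr_deriv ?_
      ring
    refine antitoneOn_of_deriv_nonpos (convex_Ici R)
      (fun r _ => (hd r).continuousAt.continuousWithinAt)
      (fun r _ => (hd r).differentiableAt.differentiableWithinAt) ?_
    intro r hr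
    rw [hIci] at hr
    rw [(hd r).deriv]
    exact mul_nonpos_of_nonneg_of_nonpos (Real.exp_pos _).le (hle r (le_of_lt hr))
  -- `g` is convex on `[R, ∞)`, so its slope at `r` is controlled by its values on `[r - 1, r]`
  have hmono' : MonotoneOn g' (Ici R) := by
    refine monotoneOn_of_deriv_nonneg (convex_Ici R)
      (fun r _ => (hg' r).continuousAt.continuousWithinAt)
      (fun r _ => (hg' r).differentiableAt.differentiableWithinAt) ?_
    intro r hr
    rw [hIci] at hr
    rw [(hg' r).deriv]
    exact (mul_nonneg (sq_nonneg c) (hpos r).le).trans (hineq r (le_of_lt hr))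
  obtain ⟨C₁, hC₁⟩ : ∃ C, ∀ r, 0 ≤ r → g r ≤ C * Real.exp (-(c * r)) := by
    refine ⟨Real.exp (c * R) * g 0, fun r hr => ?_⟩
    have hgoal : Real.exp (c * r) * g r ≤ Real.exp (c * R) * g 0 := by
      have hR0 : g R ≤ g 0 := hanti self_mem_Ici hR.le hR.le
      rcases le_total r R with h | h
      · have : g r ≤ g 0 := hanti self_mem_Ici hr hr
        have h2 : Real.exp (c * r) ≤ Real.exp (c * R) := by gcongr
        exact mul_le_mul h2 this (hpos r).le (Real.exp_pos _).le
      · exact (hantik self_mem_Ici h h).trans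
          (mul_le_mul_of_nonneg_left hR0 (Real.exp_pos _).le)
    rw [Real.exp_neg, ← div_eq_mul_inv, le_div_iff₀ (Real.exp_pos _)]
    linarith
  obtain ⟨K, hK⟩ := (isCompact_Icc (a := (0:ℝ)) (b := R + 1)).exists_bound_of_continuousOn
    (f := g') (fun r _ => (hg' r).continuousAt.continuousWithinAt)
  have hK0 : 0 ≤ K := (norm_nonneg _).trans (hK 0 ⟨le_rfl, by linarith⟩)
  have hC₁0 : 0 < C₁ := by
    have := (hpos 0).trans_le (hC₁ 0 le_rfl)
    simpa using this
  refine ⟨C₁ * Real.exp c + K * Real.exp (c * (R + 1)), fun r hr => ⟨?_, ?_⟩⟩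
  · refine (hC₁ r hr).trans ?_
    gcongr
    have := Real.one_le_exp hc.le
    have h2 : 0 ≤ K * Real.exp (c * (R + 1)) := by positivity
    nlinarith
  · rw [add_mul]
    rcases le_total r (R + 1) with h | h
    · refine (hK r ⟨hr, h⟩).trans ?_
      have h1 : 1 ≤ Real.exp (c * (R + 1)) * Real.exp (-(c * r)) := by
        rw [← Real.exp_add]
        apply Real.one_le_exp
        nlinarith
      have h2 : 0 ≤ C₁ * Real.exp c * Real.exp (-(c * r)) := by positivity
      nlinarith
    · have hr1 : R ≤ r - 1 := by linarith
      obtain ⟨ξ, hξ, hξe⟩ := exists_hasDerivAt_eq_slope g g' (show r - 1 < r by linarith)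
        (fun s _ => (hg s).continuousAt.continuousWithinAt) (fun s _ => hg s)
      have h1 : g' ξ ≤ g' r :=
        hmono' (show ξ ∈ Ici R from hr1.trans hξ.1.le) (show r ∈ Ici R by simp; linarith) hξ.2.le
      have h2 : g' ξ = g r - g (r - 1) := by rw [hξe]; simp
      have h3 := hC₁ (r - 1) (hR.le.trans hr1)
      have h4 : Real.exp (-(c * (r - 1))) = Real.exp c * Real.exp (-(c * r)) := by
        rw [← Real.exp_add]; congr 1; ring
      rw [h4] at h3
      rw [abs_of_nonpos (hneg r (by linarith))]
      have h5 : 0 ≤ K * Real.exp (c * (R + 1)) * Real.exp (-(c * r)) := by positivity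
      have := hpos r
      linarith

section lines
variable {E F : Type*} [NormedAddCommGroup E] [NormedSpace ℝ E] [NormedAddCommGroup F]
  [NormedSpace ℝ F]

lemma hasDerivAt_line {f : E → F} (hf : Differentiable ℝ f) (x v : E) (s : ℝ) :
    HasDerivAt (fun s : ℝ => f (x + s • v)) (fderiv ℝ f (x + s • v) v) s := by
  have h : HasDerivAt (fun s : ℝ => x + s • v) v s := by
    simpa using ((hasDerivAt_id s).smul_const v).const_add x
  exact (hf _).hasFDerivAt.comp_hasDerivAt s h

lemma hasDerivAt_fderiv_line {f : E → F} (hf : ContDiff ℝ 2 f) (x v : E) (s : ℝ) :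
    HasDerivAt (fun s : ℝ => fderiv ℝ f (x + s • v) v)
      (fderiv ℝ (fderiv ℝ f) (x + s • v) v v) s := by
  have h1 : Differentiable ℝ (fderiv ℝ f) :=
    (hf.fderiv_right (m := 1) (by norm_num)).differentiable (by norm_num)
  exact (hasDerivAt_line h1 x v s).clm_apply (hasDerivAt_const s v) |>.congr_deriv (by simp)

end lines

lemma laplacian_eq_sum_fderiv_fderiv {E F ι : Type*} [NormedAddCommGroup E]
    [InnerProductSpace ℝ E] [FiniteDimensional ℝ E] [NormedAddCommGroup F] [NormedSpace ℝ F]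
    [Fintype ι] (b : OrthonormalBasis ι ℝ E) (f : E → F) (x : E) :
    Laplacian.laplacian f x = ∑ i, fderiv ℝ (fderiv ℝ f) x (b i) (b i) := by
  rw [InnerProductSpace.laplacian_eq_iteratedFDeriv_orthonormalBasis f b]
  simp [iteratedFDeriv_two_apply]

/-! ### Decay of the ground state -/

namespace IsGroundState
variable {n : ℕ} {Q : Rn n → ℝ}

lemma differentiable (hQ : IsGroundState Q) : Differentiable ℝ Q :=
  hQ.contDiff.differentiable (by norm_num)

lemma isLocalMax_line (hQ : IsGroundState Q) {x v : Rn n} (hxv : inner ℝ x v = 0) :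
    IsLocalMax (fun s : ℝ => Q (x + s • v)) 0 := by
  refine Filter.Eventually.of_forall fun s => ?_
  simp only [zero_smul, add_zero]
  refine hQ.decreasing _ _ ?_
  have h : ‖x + s • v‖ ^ 2 = ‖x‖ ^ 2 + (s * ‖v‖) ^ 2 := by
    rw [norm_add_sq_real, inner_smul_right, hxv, norm_smul, Real.norm_eq_abs, mul_pow, sq_abs]
    ring
  nlinarith [norm_nonneg x, norm_nonneg (x + s • v), sq_nonneg (s * ‖v‖)]

lemma fderiv_apply_of_inner_eq_zero (hQ : IsGroundState Q) {x v : Rn n}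
    (hxv : inner ℝ x v = 0) : fderiv ℝ Q x v = 0 := by
  have h := (hasDerivAt_line hQ.differentiable x v 0).deriv
  rw [(hQ.isLocalMax_line hxv).deriv_eq_zero] at h
  simpa using h.symm

lemma fderiv_fderiv_nonpos_of_inner_eq_zero (hQ : IsGroundState Q) {x v : Rn n}
    (hxv : inner ℝ x v = 0) : fderiv ℝ (fderiv ℝ Q) x v v ≤ 0 := by
  have h := second_deriv_nonpos_of_isLocalMax (hasDerivAt_line hQ.differentiable x v)
    (hasDerivAt_fderiv_line hQ.contDiff x v 0) (hQ.isLocalMax_line hxv)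
  simpa using h

/-- The gradient at a point of the line through `e` has only a component along `e`. -/
lemma norm_fderiv_le (hQ : IsGroundState Q) {e : Rn n} (he : ‖e‖ = 1) (r : ℝ) :
    ‖fderiv ℝ Q (r • e)‖ ≤ |fderiv ℝ Q (r • e) e| := by
  refine ContinuousLinearMap.opNorm_le_bound _ (abs_nonneg _) fun v => ?_
  have h0 : inner ℝ (r • e) (v - inner ℝ e v • e) = 0 := by
    rw [inner_smul_left, inner_sub_right, inner_smul_right, real_inner_self_eq_norm_sq, he]
    simp
  have h1 := hQ.fderiv_apply_of_inner_eq_zero h0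
  rw [map_sub, map_smul, sub_eq_zero] at h1
  rw [h1, norm_smul, Real.norm_eq_abs, Real.norm_eq_abs, mul_comm]
  refine mul_le_mul_of_nonneg_left ?_ (abs_nonneg _)
  simpa [he] using abs_real_inner_le_norm e v

/-- A positive constant is not square integrable on `ℝⁿ`, so the ground state takes arbitrarily
small values. -/
lemma exists_lt (hn : 1 ≤ n) (hQ : IsGroundState Q) {δ : ℝ} (hδ : 0 < δ) : ∃ x, Q x < δ := by
  by_contra! hcon
  have : Nonempty (Fin n) := ⟨⟨0, hn⟩⟩
  have hc : MemLp (fun _ : Rn n => δ) 2 volume :=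
    hQ.memLp.mono aestronglyMeasurable_const (Filter.Eventually.of_forall fun x => by
      rw [Real.norm_of_nonneg hδ.le, Real.norm_of_nonneg (hQ.pos x).le]; exact hcon x)
  rw [memLp_const_iff (by norm_num) (by norm_num)] at hc
  rcases hc with h | h
  · exact hδ.ne' h
  · simp at h

lemma exists_rpow_le (hn : 1 ≤ n) (hQ : IsGroundState Q) :
    ∃ R, 0 < R ∧ ∀ x, R ≤ ‖x‖ → Q x ^ (4 / (n : ℝ)) ≤ 3 / 4 := by
  have hn0 : (0 : ℝ) < n := by exact_mod_cast hn
  have hδ : (0 : ℝ) < (3 / 4) ^ ((n : ℝ) / 4) := by positivity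
  obtain ⟨x₀, hx₀⟩ := hQ.exists_lt hn hδ
  refine ⟨‖x₀‖ + 1, by positivity, fun x hx => ?_⟩
  have h1 : Q x ≤ (3 / 4) ^ ((n : ℝ) / 4) :=
    (hQ.decreasing x₀ x (by linarith)).trans hx₀.le
  have h2 := Real.rpow_le_rpow (hQ.pos x).le h1 (show 0 ≤ 4 / (n : ℝ) by positivity)
  rw [← Real.rpow_mul (by norm_num), div_mul_div_cancel₀ (by norm_num), div_self hn0.ne',
    Real.rpow_one] at h2
  exact h2

/-- Along a ray the radial second derivative dominates the Laplacian, because the ground state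
is maximal at `x` on every line through `x` orthogonal to `x`. -/
lemma laplacian_le (hQ : IsGroundState Q) (i : Fin n) (r : ℝ) :
    Laplacian.laplacian Q (r • EuclideanSpace.single i (1 : ℝ)) ≤
      fderiv ℝ (fderiv ℝ Q) (r • EuclideanSpace.single i (1 : ℝ)) (EuclideanSpace.single i 1)
        (EuclideanSpace.single i 1) := by
  rw [laplacian_eq_sum_fderiv_fderiv (EuclideanSpace.basisFun (Fin n) ℝ),
    ← Finset.add_sum_erase _ _ (Finset.mem_univ i)]
  simp only [EuclideanSpace.basisFun_apply]
  refine add_le_of_nonpos_right (Finset.sum_nonpos fun j hj => ?_)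
  refine hQ.fderiv_fderiv_nonpos_of_inner_eq_zero ?_
  rw [inner_smul_left, EuclideanSpace.inner_single_left]
  simp [(Finset.ne_of_mem_erase hj).symm]

/-- Exponential decay of the ground state and of its gradient. -/
lemma exp_decay (hn : 1 ≤ n) (hQ : IsGroundState Q) :
    ∃ C, ∀ x, Q x ≤ C * Real.exp (-(1 / 2 * ‖x‖)) ∧
      ‖fderiv ℝ Q x‖ ≤ C * Real.exp (-(1 / 2 * ‖x‖)) := by
  let i : Fin n := ⟨0, hn⟩
  set e : Rn n := EuclideanSpace.single i 1 with he
  have hen : ‖e‖ = 1 := by simp [he]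
  have hline : ∀ (e : Rn n) (r : ℝ),
      HasDerivAt (fun r : ℝ => Q (r • e)) (fderiv ℝ Q (r • e) e) r := fun e r => by
    simpa using hasDerivAt_line hQ.differentiable 0 e r
  have hline2 : ∀ r : ℝ, HasDerivAt (fun r : ℝ => fderiv ℝ Q (r • e) e)
      (fderiv ℝ (fderiv ℝ Q) (r • e) e e) r := fun r => by
    simpa using hasDerivAt_fderiv_line hQ.contDiff 0 e r
  obtain ⟨R, hR, hRle⟩ := hQ.exists_rpow_le hn
  obtain ⟨C, hC⟩ := convex_decay_rate (c := 1 / 2) (by norm_num) hR (hline e) hline2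
    (fun r => hQ.pos _)
    (fun r hr s hs hrs => hQ.decreasing _ _ (by
      rw [norm_smul, norm_smul, hen, Real.norm_of_nonneg hr, Real.norm_of_nonneg hs]
      linarith))
    (fun r hr => by
      refine le_trans ?_ (hQ.laplacian_le i r)
      have hnorm : R ≤ ‖r • e‖ := by
        rw [norm_smul, hen, mul_one]; exact hr.trans (le_abs_self r)
      have heq := hQ.equation (r • e)
      have hle := hRle _ hnorm
      have hp := hQ.pos (r • e)
      rw [Real.rpow_add hp, Real.rpow_one] at heq
      nlinarith)
  refine ⟨C, fun x => ?_⟩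
  have hrad : Q x = Q (‖x‖ • e) := hQ.radial _ _ (by rw [norm_smul, hen]; simp)
  refine ⟨hrad ▸ (hC ‖x‖ (norm_nonneg x)).1, ?_⟩
  rcases eq_or_ne x 0 with rfl | hx
  · have h0 : fderiv ℝ Q 0 = 0 := by
      ext v
      simpa using hQ.fderiv_apply_of_inner_eq_zero (x := 0) (v := v) (by simp)
    rw [h0, norm_zero]
    exact (abs_nonneg _).trans (by simpa using (hC 0 le_rfl).2)
  · set e' : Rn n := ‖x‖⁻¹ • x with he'
    have he'n : ‖e'‖ = 1 := by
      rw [he', norm_smul, norm_inv, norm_norm, inv_mul_cancel₀ (norm_ne_zero_iff.2 hx)]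
    have hx' : ‖x‖ • e' = x := by
      rw [he', smul_smul, mul_inv_cancel₀ (norm_ne_zero_iff.2 hx), one_smul]
    have hsame : (fun r : ℝ => Q (r • e')) = fun r : ℝ => Q (r • e) := by
      funext r
      exact hQ.radial _ _ (by rw [norm_smul r, norm_smul r, hen, he'n])
    have hder : fderiv ℝ Q (‖x‖ • e') e' = fderiv ℝ Q (‖x‖ • e) e := by
      rw [← (hline e' ‖x‖).deriv, hsame, (hline e ‖x‖).deriv]
    have h1 := hQ.norm_fderiv_le he'n ‖x‖
    rw [hder, hx'] at h1
    exact h1.trans (hC ‖x‖ (norm_nonneg x)).2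

/-- Polynomial decay is stable under affine changes of variables up to constants, which makes it
easier to use than exponential decay. -/
lemma poly_decay (hn : 1 ≤ n) (hQ : IsGroundState Q) (k : ℕ) :
    ∃ C, 0 ≤ C ∧ ∀ x, Q x * (1 + ‖x‖) ^ k ≤ C ∧ ‖fderiv ℝ Q x‖ * (1 + ‖x‖) ^ k ≤ C := by
  obtain ⟨C, hC⟩ := hQ.exp_decay hn
  have hC0 : 0 < C := by
    have := (hQ.pos 0).trans_le (hC 0).1
    simpa using this
  set K : ℝ := 2 ^ k * k.factorial * Real.exp (1 / 2) with hK
  have key : ∀ x : Rn n, Real.exp (-(1 / 2 * ‖x‖)) * (1 + ‖x‖) ^ k ≤ K := by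
    intro x
    have h := Real.pow_div_factorial_le_exp ((1 + ‖x‖) / 2) (by positivity) k
    rw [div_pow, div_div, div_le_iff₀ (by positivity)] at h
    have h2 : Real.exp (-(1 / 2 * ‖x‖)) * Real.exp ((1 + ‖x‖) / 2) = Real.exp (1 / 2) := by
      rw [← Real.exp_add]; congr 1; ring
    calc _ ≤ Real.exp (-(1 / 2 * ‖x‖)) * (Real.exp ((1 + ‖x‖) / 2) * (2 ^ k * k.factorial)) :=
          mul_le_mul_of_nonneg_left h (Real.exp_pos _).le
      _ = (Real.exp (-(1 / 2 * ‖x‖)) * Real.exp ((1 + ‖x‖) / 2)) * (2 ^ k * k.factorial) := by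
          ring
      _ = K := by rw [h2, hK]; ring
  have key' : ∀ (x : Rn n) (q : ℝ), q ≤ C * Real.exp (-(1 / 2 * ‖x‖)) →
      q * (1 + ‖x‖) ^ k ≤ C * K := by
    intro x q hq
    calc _ ≤ C * Real.exp (-(1 / 2 * ‖x‖)) * (1 + ‖x‖) ^ k := by gcongr
      _ = C * (Real.exp (-(1 / 2 * ‖x‖)) * (1 + ‖x‖) ^ k) := by ring
      _ ≤ C * K := by gcongr; exact key x
  exact ⟨C * K, by positivity, fun x => ⟨key' x _ (hC x).1, key' x _ (hC x).2⟩⟩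

end IsGroundState

/-! ### Modulated ground states at a fixed time -/

/-- The modulated profile `d^(-n/2) exp(i (θ|x|² + β)) Q(Lx/d - x₀)` at a fixed time, with scale `d`,
quadratic phase `θ`, constant phase `β`, and a linear map `L`, meant to be an isometry. -/
noncomputable def quadWave {n : ℕ} (Q : Rn n → ℝ) (x₀ : Rn n) (d θ β : ℝ) (L : Rn n →L[ℝ] Rn n)
    (x : Rn n) : ℂ :=
  ((1 / d ^ ((n : ℝ) / 2) : ℝ) : ℂ) * Complex.exp (Complex.I * ((θ * ‖x‖ ^ 2 + β : ℝ) : ℂ))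
    * ((Q (d⁻¹ • L x - x₀) : ℝ) : ℂ)

section
variable {n : ℕ} {Q : Rn n → ℝ} {x₀ : Rn n} {d θ β : ℝ} {L : Rn n →L[ℝ] Rn n}

lemma hasDerivAt_normSq_line (x v : Rn n) (s : ℝ) :
    HasDerivAt (fun s : ℝ => ‖x + s • v‖ ^ 2) (2 * inner ℝ (x + s • v) v) s := by
  have h : HasDerivAt (fun s : ℝ => x + s • v) v s := by
    simpa using ((hasDerivAt_id s).smul_const v).const_add x
  exact h.norm_sq

lemma hasDerivAt_phase_line (θ β : ℝ) (x v : Rn n) (s : ℝ) :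
    HasDerivAt
      (fun s : ℝ => Complex.exp (Complex.I * ((θ * ‖x + s • v‖ ^ 2 + β : ℝ) : ℂ)))
      (Complex.exp (Complex.I * ((θ * ‖x + s • v‖ ^ 2 + β : ℝ) : ℂ)) *
        (Complex.I * ((2 * θ * inner ℝ (x + s • v) v : ℝ) : ℂ))) s := by
  have h := ((((hasDerivAt_normSq_line x v s).const_mul θ).add_const β).ofReal_comp).const_mul
    Complex.I
  refine h.cexp.congr_deriv ?_
  push_cast
  ring

lemma shift_line (d : ℝ) (L : Rn n →L[ℝ] Rn n) (x₀ x v : Rn n) (s : ℝ) :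
    d⁻¹ • L (x + s • v) - x₀ = (d⁻¹ • L x - x₀) + s • (d⁻¹ • L v) := by
  rw [map_add, map_smul, smul_add, smul_comm d⁻¹ s]
  abel

lemma hasDerivAt_quadWave_line (hQ : Differentiable ℝ Q) (x v : Rn n) (s : ℝ) :
    HasDerivAt (fun s : ℝ => quadWave Q x₀ d θ β L (x + s • v))
      (((1 / d ^ ((n : ℝ) / 2) : ℝ) : ℂ) *
        Complex.exp (Complex.I * ((θ * ‖x + s • v‖ ^ 2 + β : ℝ) : ℂ)) *
        (Complex.I * ((2 * θ * inner ℝ (x + s • v) v * Q (d⁻¹ • L (x + s • v) - x₀) : ℝ) : ℂ) +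
          ((d⁻¹ * fderiv ℝ Q (d⁻¹ • L (x + s • v) - x₀) (L v) : ℝ) : ℂ))) s := by
  have h1 := (hasDerivAt_phase_line θ β x v s).const_mul (((1 / d ^ ((n : ℝ) / 2) : ℝ) : ℂ))
  have h2 := (hasDerivAt_line hQ (d⁻¹ • L x - x₀) (d⁻¹ • L v) s).ofReal_comp
  simp only [← shift_line] at h2
  refine (h1.mul h2).congr_deriv ?_
  simp only [map_smul, smul_eq_mul]
  push_cast
  ring

lemma contDiff_quadWave {k : WithTop ℕ∞} (hQ : ContDiff ℝ k Q) :
    ContDiff ℝ k (quadWave Q x₀ d θ β L) := by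
  unfold quadWave
  refine (contDiff_const.mul (contDiff_const.mul (Complex.ofRealCLM.contDiff.comp
    ((contDiff_const.mul (contDiff_norm_sq ℝ)).add contDiff_const))).cexp).mul
      (Complex.ofRealCLM.contDiff.comp (hQ.comp ?_))
  exact (L.contDiff.const_smul d⁻¹).sub contDiff_const

lemma fderiv_quadWave_apply (hQ : ContDiff ℝ 1 Q) (x v : Rn n) :
    fderiv ℝ (quadWave Q x₀ d θ β L) x v =
      ((1 / d ^ ((n : ℝ) / 2) : ℝ) : ℂ) *
        Complex.exp (Complex.I * ((θ * ‖x‖ ^ 2 + β : ℝ) : ℂ)) *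
        (Complex.I * ((2 * θ * inner ℝ x v * Q (d⁻¹ • L x - x₀) : ℝ) : ℂ) +
          ((d⁻¹ * fderiv ℝ Q (d⁻¹ • L x - x₀) (L v) : ℝ) : ℂ)) := by
  have hd : Differentiable ℝ (quadWave Q x₀ d θ β L) :=
    (contDiff_quadWave hQ).differentiable (by norm_num)
  have h := (hasDerivAt_line hd x v 0).unique
    (hasDerivAt_quadWave_line (hQ.differentiable (by norm_num)) x v 0)
  simpa using h

lemma fderiv_fderiv_quadWave_apply (hQ : ContDiff ℝ 2 Q) (x v : Rn n) :
    fderiv ℝ (fderiv ℝ (quadWave Q x₀ d θ β L)) x v v =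
      ((1 / d ^ ((n : ℝ) / 2) : ℝ) : ℂ) *
        Complex.exp (Complex.I * ((θ * ‖x‖ ^ 2 + β : ℝ) : ℂ)) *
        (Complex.I * ((2 * θ * ‖v‖ ^ 2 * Q (d⁻¹ • L x - x₀) : ℝ) : ℂ)
          - ((4 * θ ^ 2 * inner ℝ x v ^ 2 * Q (d⁻¹ • L x - x₀) : ℝ) : ℂ)
          + Complex.I *
            ((4 * θ * inner ℝ x v * (d⁻¹ * fderiv ℝ Q (d⁻¹ • L x - x₀) (L v)) : ℝ) : ℂ)
          + (((d⁻¹) ^ 2 * fderiv ℝ (fderiv ℝ Q) (d⁻¹ • L x - x₀) (L v) (L v) : ℝ) : ℂ)) := by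
  have hQ1 : ContDiff ℝ 1 Q := hQ.of_le (by norm_num)
  have h := hasDerivAt_fderiv_line (contDiff_quadWave (x₀ := x₀) (d := d) (θ := θ) (β := β)
    (L := L) hQ) x v 0
  simp only [fderiv_quadWave_apply hQ1] at h
  have h1 := (hasDerivAt_phase_line θ β x v 0).const_mul (((1 / d ^ ((n : ℝ) / 2) : ℝ) : ℂ))
  have hin : HasDerivAt (fun s : ℝ => 2 * θ * inner ℝ (x + s • v) v) (2 * θ * ‖v‖ ^ 2) 0 := by
    have : (fun s : ℝ => 2 * θ * inner ℝ (x + s • v) v) =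
        fun s : ℝ => 2 * θ * (inner ℝ x v + s * ‖v‖ ^ 2) := by
      funext s
      rw [inner_add_left, inner_smul_left, real_inner_self_eq_norm_sq]
      simp
    rw [this]
    simpa using (((hasDerivAt_id (0 : ℝ)).mul_const (‖v‖ ^ 2)).const_add (inner ℝ x v)).const_mul
      (2 * θ)
  have h2 := hasDerivAt_line (hQ.differentiable (by norm_num)) (d⁻¹ • L x - x₀) (d⁻¹ • L v) 0
  have h3 := hasDerivAt_fderiv_line hQ (d⁻¹ • L x - x₀) (d⁻¹ • L v) 0
  simp only [← shift_line, map_smul, smul_eq_mul] at h2 h3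
  have h4 := h1.mul (((hin.mul h2).ofReal_comp.const_mul Complex.I).add h3.ofReal_comp)
  have h5 := h.unique h4
  simp only [zero_smul, add_zero, smul_apply, smul_eq_mul, Pi.add_apply,
    Pi.mul_apply] at h5
  rw [h5]
  push_cast
  linear_combination (1 / ((d ^ ((n : ℝ) / 2) : ℝ) : ℂ) *
        Complex.exp (Complex.I * (θ * (‖x‖ : ℂ) ^ 2 + β)) * 4 * (θ : ℂ) ^ 2 *
        ((inner ℝ x v : ℝ) : ℂ) ^ 2 * ((Q (d⁻¹ • L x - x₀) : ℝ) : ℂ)) * Complex.I_sq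

/-- A norm-preserving linear map of `ℝⁿ`, as an isometric equivalence. -/
noncomputable def isometryEquiv (L : Rn n →L[ℝ] Rn n) (hL : ∀ x, ‖L x‖ = ‖x‖) : Rn n ≃ₗᵢ[ℝ] Rn n :=
  LinearIsometry.toLinearIsometryEquiv ⟨L.toLinearMap, hL⟩ rfl

@[simp] lemma isometryEquiv_apply (hL : ∀ x, ‖L x‖ = ‖x‖) (x : Rn n) :
    isometryEquiv L hL x = L x := rfl

lemma sum_inner_smul_apply (f : Rn n →L[ℝ] ℝ) (x : Rn n) :
    ∑ j, inner ℝ x (EuclideanSpace.single j (1 : ℝ)) * f (EuclideanSpace.single j 1) = f x := by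
  have h := congrArg f ((EuclideanSpace.basisFun (Fin n) ℝ).sum_repr' x)
  rw [map_sum] at h
  rw [← h]
  refine Finset.sum_congr rfl fun j _ => ?_
  rw [map_smul, smul_eq_mul, real_inner_comm, EuclideanSpace.basisFun_apply]

lemma sum_inner_sq (x : Rn n) :
    ∑ j, inner ℝ x (EuclideanSpace.single j (1 : ℝ)) ^ 2 = ‖x‖ ^ 2 := by
  have h := (EuclideanSpace.basisFun (Fin n) ℝ).sum_sq_inner_left x
  simpa using h

lemma sum_apply_sq_eq_norm_sq (f : Rn n →L[ℝ] ℝ) (hL : ∀ x, ‖L x‖ = ‖x‖) :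
    ∑ j, f (L (EuclideanSpace.single j 1)) ^ 2 = ‖f‖ ^ 2 := by
  have h := ((EuclideanSpace.basisFun (Fin n) ℝ).map (isometryEquiv L hL)).sum_sq_inner_left
    ((InnerProductSpace.toDual ℝ (Rn n)).symm f)
  simpa [InnerProductSpace.toDual_symm_apply] using h

lemma laplacian_quadWave (hQ : ContDiff ℝ 2 Q) (hL : ∀ x, ‖L x‖ = ‖x‖) (x : Rn n) :
    Laplacian.laplacian (quadWave Q x₀ d θ β L) x =
      ((1 / d ^ ((n : ℝ) / 2) : ℝ) : ℂ) *
        Complex.exp (Complex.I * ((θ * ‖x‖ ^ 2 + β : ℝ) : ℂ)) *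
        (Complex.I * ((2 * θ * n * Q (d⁻¹ • L x - x₀) : ℝ) : ℂ)
          - ((4 * θ ^ 2 * ‖x‖ ^ 2 * Q (d⁻¹ • L x - x₀) : ℝ) : ℂ)
          + Complex.I *
            ((4 * θ * (d⁻¹ * fderiv ℝ Q (d⁻¹ • L x - x₀) (L x)) : ℝ) : ℂ)
          + (((d⁻¹) ^ 2 * Laplacian.laplacian Q (d⁻¹ • L x - x₀) : ℝ) : ℂ)) := by
  rw [laplacian_eq_sum_fderiv_fderiv (EuclideanSpace.basisFun (Fin n) ℝ),
    laplacian_eq_sum_fderiv_fderiv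
      ((EuclideanSpace.basisFun (Fin n) ℝ).map (isometryEquiv L hL))]
  simp only [EuclideanSpace.basisFun_apply, OrthonormalBasis.map_apply, isometryEquiv_apply,
    fderiv_fderiv_quadWave_apply hQ]
  rw [← Finset.mul_sum, Finset.sum_add_distrib, Finset.sum_add_distrib, Finset.sum_sub_distrib,
    ← Finset.mul_sum, ← Finset.mul_sum]
  simp only [← Complex.ofReal_sum]
  have h1 : ∑ j : Fin n, 2 * θ * ‖(EuclideanSpace.single j (1 : ℝ) : Rn n)‖ ^ 2 *
      Q (d⁻¹ • L x - x₀) = 2 * θ * n * Q (d⁻¹ • L x - x₀) := by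
    simp; ring
  have h2 : ∑ j : Fin n, 4 * θ ^ 2 * inner ℝ x (EuclideanSpace.single j (1 : ℝ)) ^ 2 *
      Q (d⁻¹ • L x - x₀) = 4 * θ ^ 2 * ‖x‖ ^ 2 * Q (d⁻¹ • L x - x₀) := by
    rw [← Finset.sum_mul, ← Finset.mul_sum, sum_inner_sq]
  have h3 : ∑ j : Fin n, 4 * θ * inner ℝ x (EuclideanSpace.single j (1 : ℝ)) *
      (d⁻¹ * fderiv ℝ Q (d⁻¹ • L x - x₀) (L (EuclideanSpace.single j 1))) =
      4 * θ * (d⁻¹ * fderiv ℝ Q (d⁻¹ • L x - x₀) (L x)) := by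
    have h := sum_inner_smul_apply ((fderiv ℝ Q (d⁻¹ • L x - x₀)).comp L) x
    simp only [ContinuousLinearMap.comp_apply] at h
    rw [← h, Finset.mul_sum, Finset.mul_sum]
    exact Finset.sum_congr rfl fun j _ => by ring
  rw [h1, h2, h3, ← Finset.mul_sum]

lemma norm_phase (r : ℝ) : ‖Complex.exp (Complex.I * (r : ℂ))‖ = 1 := by
  rw [mul_comm]; exact Complex.norm_exp_ofReal_mul_I r

lemma norm_quadWave (hd : 0 < d) (hQ : ∀ x, 0 < Q x) (x : Rn n) :
    ‖quadWave Q x₀ d θ β L x‖ = 1 / d ^ ((n : ℝ) / 2) * Q (d⁻¹ • L x - x₀) := by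
  have h : (0 : ℝ) < 1 / d ^ ((n : ℝ) / 2) := by positivity
  rw [quadWave, norm_mul, norm_mul, norm_phase, Complex.norm_real, Complex.norm_real,
    Real.norm_of_nonneg h.le, Real.norm_of_nonneg (hQ _).le, mul_one]

lemma one_div_rpow_half_sq (hd : 0 < d) : (1 / d ^ ((n : ℝ) / 2)) ^ 2 = 1 / d ^ n := by
  rw [div_pow, one_pow, ← Real.rpow_natCast (d ^ ((n : ℝ) / 2)) 2, ← Real.rpow_mul hd.le,
    ← Real.rpow_natCast d n]
  congr 2
  push_cast
  ring

/-- The real amplitude turns the two terms of the gradient of the wave into orthogonal ones: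
one is the derivative of the phase, the other that of the modulus. -/
lemma norm_cgrad_quadWave_sq (hd : 0 < d) (hQ : ContDiff ℝ 1 Q) (hL : ∀ x, ‖L x‖ = ‖x‖)
    (x : Rn n) :
    ‖cgrad (quadWave Q x₀ d θ β L) x‖ ^ 2 = 1 / d ^ n *
      (4 * θ ^ 2 * ‖x‖ ^ 2 * Q (d⁻¹ • L x - x₀) ^ 2 +
        (d⁻¹) ^ 2 * ‖fderiv ℝ Q (d⁻¹ • L x - x₀)‖ ^ 2) := by
  have h0 : ∀ p q : ℝ, ‖Complex.I * (p : ℂ) + (q : ℂ)‖ ^ 2 = p ^ 2 + q ^ 2 := by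
    intro p q
    rw [Complex.sq_norm, Complex.normSq_apply]
    simp
    ring
  rw [EuclideanSpace.norm_sq_eq, ← sum_inner_sq x, ← sum_apply_sq_eq_norm_sq _ hL,
    Finset.mul_sum, Finset.sum_mul, Finset.mul_sum, ← Finset.sum_add_distrib, Finset.mul_sum]
  refine Finset.sum_congr rfl fun j _ => ?_
  simp only [cgrad]
  rw [fderiv_quadWave_apply hQ, norm_mul, norm_mul, norm_phase, mul_pow, h0, mul_one,
    Complex.norm_real, Real.norm_eq_abs, sq_abs, one_div_rpow_half_sq hd]
  ring

lemma integral_comp_affine (hd : 0 < d) (hL : ∀ x, ‖L x‖ = ‖x‖) (F : Rn n → ℝ) :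
    ∫ x, F (d⁻¹ • L x - x₀) = d ^ n * ∫ y, F y := by
  have h1 := (isometryEquiv L hL).measurePreserving.integral_comp
    (isometryEquiv L hL).toHomeomorph.measurableEmbedding (fun x => F (d⁻¹ • x - x₀))
  simp only [isometryEquiv_apply] at h1
  rw [h1, Measure.integral_comp_smul volume (fun x => F (x - x₀)),
    integral_sub_right_eq_self F x₀]
  simp [abs_of_pos hd]

end

/-! ### Decay in space and continuity in `Σ` -/

section
variable {n : ℕ}

lemma memLp_two_inv_one_add_norm_pow (K : ℝ) :
    MemLp (fun x : Rn n => K / (1 + ‖x‖) ^ (n + 1)) 2 volume := by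
  have hmeas : AEStronglyMeasurable (fun x : Rn n => ((1 + ‖x‖) ^ (n + 1))⁻¹) volume :=
    Measurable.aestronglyMeasurable (by fun_prop)
  have hint : Integrable (fun x : Rn n => (1 + ‖x‖) ^ (-((n : ℝ) + 1))) volume :=
    integrable_one_add_norm (by simp)
  have h : MemLp (fun x : Rn n => ((1 + ‖x‖) ^ (n + 1))⁻¹) 2 volume := by
    rw [memLp_two_iff_integrable_sq hmeas]
    refine hint.mono (hmeas.pow 2) (Eventually.of_forall fun x => ?_)
    have h1 : (1 : ℝ) ≤ (1 + ‖x‖) ^ (n + 1) := one_le_pow₀ (by simp)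
    have h2 : (1 + ‖x‖) ^ (-((n : ℝ) + 1)) = ((1 + ‖x‖) ^ (n + 1))⁻¹ := by
      rw [Real.rpow_neg (by positivity), ← Real.rpow_natCast]
      push_cast
      rfl
    rw [h2, Real.norm_of_nonneg (by positivity), Real.norm_of_nonneg (by positivity), sq]
    exact mul_le_of_le_one_left (by positivity) (inv_le_one_of_one_le₀ h1)
  simpa [div_eq_mul_inv] using h.const_mul K

/-- Dominated convergence in `L²`, for norms. -/
lemma tendsto_eLpNorm_two_zero {E : Type*} [NormedAddCommGroup E] {l : Filter ℝ}
    [l.IsCountablyGenerated] {F : ℝ → Rn n → E} {g : Rn n → ℝ}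
    (hF : ∀ᶠ s in l, AEStronglyMeasurable (F s) volume)
    (hb : ∀ᶠ s in l, ∀ x, ‖F s x‖ ≤ g x) (hg : MemLp g 2 volume)
    (hlim : ∀ x, Tendsto (fun s => F s x) l (𝓝 0)) :
    Tendsto (fun s => eLpNorm (F s) 2 volume) l (𝓝 0) := by
  have key : Tendsto (fun s => ∫⁻ x, ‖F s x‖ₑ ^ (2 : ℝ)) l (𝓝 (∫⁻ _ : Rn n, 0)) := by
    refine tendsto_lintegral_filter_of_dominated_convergence' (fun x => ‖g x‖ₑ ^ (2 : ℝ))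
      ?_ ?_ ?_ ?_
    · filter_upwards [hF] with s hs using hs.enorm.pow_const 2
    · filter_upwards [hb] with s hs
      refine Eventually.of_forall fun x => ?_
      refine ENNReal.rpow_le_rpow ?_ (by norm_num)
      exact enorm_le_iff_norm_le.2 ((hs x).trans (le_abs_self _))
    · have := lintegral_rpow_enorm_lt_top_of_eLpNorm_lt_top (by norm_num) (by norm_num) hg.2
      simpa using this.ne
    · refine Eventually.of_forall fun x => ?_
      have h1 : Tendsto (fun s => ‖F s x‖ₑ) l (𝓝 0) := by
        simpa [Function.comp_def] using (continuous_enorm.tendsto (0 : E)).comp (hlim x)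
      simpa using h1.ennrpow_const (2 : ℝ)
  have h2 := key.ennrpow_const (1 / 2 : ℝ)
  simp only [lintegral_zero] at h2
  rw [ENNReal.zero_rpow_of_pos (by norm_num)] at h2
  refine h2.congr fun s => ?_
  rw [eLpNorm_eq_lintegral_rpow_enorm_toReal (by norm_num) (by norm_num)]
  simp

/-- Decay of a function and of its gradient fast enough for membership in `Σ`, with an explicit
constant. -/
def SigmaDecay (K : ℝ) (f : Rn n → ℂ) : Prop :=
  ∀ x, ‖f x‖ * (1 + ‖x‖) ^ (n + 2) ≤ K ∧ ‖cgrad f x‖ * (1 + ‖x‖) ^ (n + 1) ≤ K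

namespace SigmaDecay
variable {K : ℝ} {f : Rn n → ℂ}

lemma norm_le (h : SigmaDecay K f) (x : Rn n) : ‖f x‖ ≤ K / (1 + ‖x‖) ^ (n + 1) := by
  rw [le_div_iff₀ (by positivity)]
  refine le_trans ?_ (h x).1
  gcongr
  · simp
  · norm_num

lemma norm_weight_le (h : SigmaDecay K f) (x : Rn n) :
    ‖‖x‖ • f x‖ ≤ K / (1 + ‖x‖) ^ (n + 1) := by
  rw [le_div_iff₀ (by positivity), norm_smul, norm_norm]
  refine le_trans ?_ (h x).1
  have h1 : ‖x‖ ≤ 1 + ‖x‖ := by simp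
  calc ‖x‖ * ‖f x‖ * (1 + ‖x‖) ^ (n + 1) ≤ (1 + ‖x‖) * ‖f x‖ * (1 + ‖x‖) ^ (n + 1) := by gcongr
    _ = _ := by ring

lemma norm_cgrad_le (h : SigmaDecay K f) (x : Rn n) :
    ‖cgrad f x‖ ≤ K / (1 + ‖x‖) ^ (n + 1) := by
  rw [le_div_iff₀ (by positivity)]
  exact (h x).2

end SigmaDecay

lemma continuous_cgrad {f : Rn n → ℂ} (hf : ContDiff ℝ 1 f) : Continuous (cgrad f) := by
  have h : Continuous (fderiv ℝ f) := hf.continuous_fderiv (by norm_num)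
  unfold cgrad
  fun_prop

lemma cgrad_sub {f g : Rn n → ℂ} (hf : ContDiff ℝ 1 f) (hg : ContDiff ℝ 1 g) (x : Rn n) :
    cgrad (fun y => f y - g y) x = cgrad f x - cgrad g x := by
  ext j
  simp only [cgrad, PiLp.sub_apply]
  rw [fderiv_fun_sub (hf.differentiable (by norm_num) x) (hg.differentiable (by norm_num) x)]
  rfl

lemma memSigma_of_sigmaDecay {K : ℝ} {f : Rn n → ℂ} (hf : ContDiff ℝ 1 f)
    (h : SigmaDecay K f) : MemSigma f where
  contDiff := hf
  memLp := (memLp_two_inv_one_add_norm_pow K).mono' hf.continuous.aestronglyMeasurable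
    (Eventually.of_forall h.norm_le)
  memLp_grad := (memLp_two_inv_one_add_norm_pow K).mono'
    (continuous_cgrad hf).aestronglyMeasurable (Eventually.of_forall h.norm_cgrad_le)
  memLp_weight := (memLp_two_inv_one_add_norm_pow K).mono'
    (continuous_norm.smul hf.continuous).aestronglyMeasurable
    (Eventually.of_forall h.norm_weight_le)

/-- Pointwise continuity in time of a function and of its gradient, together with decay in space
that is locally uniform in time, gives continuity in `Σ`. -/
lemma continuousInSigma_of_sigmaDecay {I : Set ℝ} {u : ℝ → Rn n → ℂ}
    (hu : ∀ t ∈ I, ContDiff ℝ 1 (u t))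
    (hdecay : ∀ t ∈ I, ∃ K, ∀ᶠ s in 𝓝[I] t, SigmaDecay K (u s))
    (hcont : ∀ t ∈ I, ∀ x, ContinuousWithinAt (fun s => u s x) I t)
    (hcontg : ∀ t ∈ I, ∀ x, ContinuousWithinAt (fun s => cgrad (u s) x) I t) :
    ContinuousInSigma I u := by
  intro t ht
  obtain ⟨K, hK⟩ := hdecay t ht
  have hKt : SigmaDecay K (u t) := hK.self_of_nhdsWithin ht
  refine ⟨memSigma_of_sigmaDecay (hu t ht) hKt, ?_⟩
  have hmem : ∀ᶠ s in 𝓝[I] t, s ∈ I := self_mem_nhdsWithin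
  have hcg : ∀ s ∈ I, ∀ x, cgrad (fun y => u s y - u t y) x = cgrad (u s) x - cgrad (u t) x :=
    fun s hs x => cgrad_sub (hu s hs) (hu t ht) x
  have hdom : ∀ {E : Type} [NormedAddCommGroup E] {a b : E} {x : Rn n},
      ‖a‖ ≤ K / (1 + ‖x‖) ^ (n + 1) → ‖b‖ ≤ K / (1 + ‖x‖) ^ (n + 1) →
      ‖a - b‖ ≤ (2 * K) / (1 + ‖x‖) ^ (n + 1) := by
    intro E _ a b x ha hb
    refine (norm_sub_le a b).trans ((add_le_add ha hb).trans_eq ?_)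
    ring
  have h0 : ∀ x, Tendsto (fun s => u s x - u t x) (𝓝[I] t) (𝓝 0) := fun x => by
    simpa using (hcont t ht x).tendsto.sub_const (u t x)
  have h1 := tendsto_eLpNorm_two_zero (F := fun s x => u s x - u t x) (l := 𝓝[I] t)
    (hmem.mono fun s hs =>
      ((hu s hs).continuous.sub (hu t ht).continuous).aestronglyMeasurable)
    (hK.mono fun s hs x => hdom (hs.norm_le x) (hKt.norm_le x))
    (memLp_two_inv_one_add_norm_pow (2 * K)) h0
  have h2 := tendsto_eLpNorm_two_zero (F := fun s x => cgrad (fun y => u s y - u t y) x)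
    (l := 𝓝[I] t)
    (hmem.mono fun s hs =>
      (continuous_cgrad ((hu s hs).sub (hu t ht))).aestronglyMeasurable)
    ((hK.and hmem).mono fun s hs x => by
      rw [hcg s hs.2]
      exact hdom (hs.1.norm_cgrad_le x) (hKt.norm_cgrad_le x))
    (memLp_two_inv_one_add_norm_pow (2 * K))
    (fun x => by
      have h : Tendsto (fun s => cgrad (u s) x - cgrad (u t) x) (𝓝[I] t) (𝓝 0) := by
        simpa using (hcontg t ht x).tendsto.sub_const (cgrad (u t) x)
      refine h.congr' (hmem.mono fun s hs => ?_)
      exact (hcg s hs x).symm)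
  have h3 := tendsto_eLpNorm_two_zero (F := fun s x => ‖x‖ • (u s x - u t x)) (l := 𝓝[I] t)
    (hmem.mono fun s hs =>
      (continuous_norm.smul
        ((hu s hs).continuous.sub (hu t ht).continuous)).aestronglyMeasurable)
    (hK.mono fun s hs x => by
      rw [smul_sub]
      exact hdom (hs.norm_weight_le x) (hKt.norm_weight_le x))
    (memLp_two_inv_one_add_norm_pow (2 * K))
    (fun x => by simpa using (h0 x).const_smul ‖x‖)
  simpa [sigmaNorm] using (h1.add h2).add h3

end

/-! ### The rotation `e^{tM}` -/

section
variable {n : ℕ}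

/-- The linear map `x ↦ e^{tM} x` of `ℝⁿ`. -/
noncomputable def matFlow (M : Matrix (Fin n) (Fin n) ℝ) (t : ℝ) : Rn n →L[ℝ] Rn n :=
  Matrix.toEuclideanCLM (n := Fin n) (𝕜 := ℝ) (NormedSpace.exp (t • M))

lemma matFlow_apply (M : Matrix (Fin n) (Fin n) ℝ) (t : ℝ) (x : Rn n) :
    matFlow M t x = matAct (NormedSpace.exp (t • M)) x := rfl

lemma matFlow_eq_exp (M : Matrix (Fin n) (Fin n) ℝ) (t : ℝ) :
    matFlow M t = NormedSpace.exp (t • Matrix.toEuclideanCLM (n := Fin n) (𝕜 := ℝ) M) := by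
  let : NormedRing (Matrix (Fin n) (Fin n) ℝ) := Matrix.linftyOpNormedRing
  let : NormedAlgebra ℚ (Matrix (Fin n) (Fin n) ℝ) := Matrix.linftyOpNormedAlgebra
  let : NormedAlgebra ℚ (Rn n →L[ℝ] Rn n) := NormedAlgebra.restrictScalars ℚ ℝ _
  let e := (Matrix.toEuclideanCLM (n := Fin n) (𝕜 := ℝ)).symm
  have hc : Continuous e :=
    LinearMap.continuous_of_finiteDimensional e.toAlgEquiv.toLinearMap
  have h := NormedSpace.map_exp e hc (t • Matrix.toEuclideanCLM (n := Fin n) (𝕜 := ℝ) M)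
  rw [map_smul, StarAlgEquiv.symm_apply_apply] at h
  have h2 := congrArg (Matrix.toEuclideanCLM (n := Fin n) (𝕜 := ℝ)) h
  rw [StarAlgEquiv.apply_symm_apply] at h2
  exact h2.symm

lemma contDiff_matFlow (M : Matrix (Fin n) (Fin n) ℝ) {k : WithTop ℕ∞} :
    ContDiff ℝ k (matFlow M) := by
  have h1 : ContDiff ℝ k (NormedSpace.exp : (Rn n →L[ℝ] Rn n) → _) :=
    contDiff_iff_contDiffAt.2 fun x => (NormedSpace.exp_analytic (𝕂 := ℝ) x).contDiffAt
  have h2 : matFlow M = fun t => NormedSpace.exp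
      (t • Matrix.toEuclideanCLM (n := Fin n) (𝕜 := ℝ) M) := funext (matFlow_eq_exp M)
  rw [h2]
  exact h1.comp (contDiff_id.smul contDiff_const)

lemma hasDerivAt_matFlow (M : Matrix (Fin n) (Fin n) ℝ) (t : ℝ) (x : Rn n) :
    HasDerivAt (fun s => matFlow M s x) (matFlow M t (matAct M x)) t := by
  have h := hasDerivAt_exp_smul_const (𝕂 := ℝ)
    (Matrix.toEuclideanCLM (n := Fin n) (𝕜 := ℝ) M) t
  simp only [← matFlow_eq_exp] at h
  exact (h.clm_apply (hasDerivAt_const t x)).congr_deriv (by simp; rfl)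

lemma inner_matAct_self {M : Matrix (Fin n) (Fin n) ℝ} (hM : M.transpose = -M) (x : Rn n) :
    inner ℝ x (matAct M x) = 0 := by
  have h : inner ℝ x (matAct M x) = x.ofLp ⬝ᵥ M.mulVec x.ofLp := Matrix.inner_toEuclideanCLM M x x
  have h2 : x.ofLp ⬝ᵥ M.mulVec x.ofLp = - (x.ofLp ⬝ᵥ M.mulVec x.ofLp) := by
    calc x.ofLp ⬝ᵥ M.mulVec x.ofLp = M.transpose.mulVec x.ofLp ⬝ᵥ x.ofLp := by
          rw [Matrix.dotProduct_mulVec, Matrix.mulVec_transpose]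
      _ = _ := by rw [hM, Matrix.neg_mulVec, neg_dotProduct, dotProduct_comm]
  rw [h]
  linarith

/-- For skew-symmetric `M` the function `|e^{tM}x|²` has derivative
`2 ⟪e^{tM}x, M e^{tM}x⟫ = 0`. -/
lemma norm_matFlow {M : Matrix (Fin n) (Fin n) ℝ} (hM : M.transpose = -M) (t : ℝ) (x : Rn n) :
    ‖matFlow M t x‖ = ‖x‖ := by
  have hd : ∀ s, HasDerivAt (fun s => ‖matFlow M s x‖ ^ 2) 0 s := by
    intro s
    have h := hasDerivAt_exp_smul_const' (𝕂 := ℝ)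
      (Matrix.toEuclideanCLM (n := Fin n) (𝕜 := ℝ) M) s
    simp only [← matFlow_eq_exp] at h
    have h2 := (h.clm_apply (hasDerivAt_const s x)).norm_sq
    refine h2.congr_deriv ?_
    have h3 := inner_matAct_self hM (matFlow M s x)
    simp only [map_zero, add_zero]
    exact mul_eq_zero_of_right 2 h3
  have h := is_const_of_deriv_eq_zero (fun s => (hd s).differentiableAt)
    (fun s => (hd s).deriv) t 0
  have h0 : matFlow M 0 x = x := by
    have h1 : (0 : ℝ) • M = 0 := zero_smul ℝ M
    rw [matFlow, h1, NormedSpace.exp_zero, map_one]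
    rfl
  simp only [h0] at h
  exact (sq_eq_sq₀ (norm_nonneg _) (norm_nonneg _)).1 h

end

section
variable {n : ℕ} {Q : Rn n → ℝ} {x₀ : Rn n}

/-- The decay constant depends only on bounds for the parameters, because `1 + |x|` is bounded by a
multiple of `1 + |y|` when `y = Lx/d - x₀`. -/
lemma IsGroundState.exists_sigmaDecay_quadWave (hn : 1 ≤ n) (hQ : IsGroundState Q) (x₀ : Rn n)
    {m B : ℝ} (hm : 0 < m) (hB : 0 ≤ B) :
    ∃ K, ∀ (d θ β : ℝ) (L : Rn n →L[ℝ] Rn n), m ≤ d → d ≤ B → |θ| ≤ B → (∀ x, ‖L x‖ = ‖x‖) →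
      SigmaDecay K (quadWave Q x₀ d θ β L) := by
  obtain ⟨C, hC0, hC⟩ := hQ.poly_decay hn (n + 2)
  set Λ : ℝ := 1 + B + B * ‖x₀‖ with hΛ
  have hΛ1 : 1 ≤ Λ := by
    have : 0 ≤ B * ‖x₀‖ := by positivity
    linarith
  set A : ℝ := 1 / m ^ ((n : ℝ) / 2) with hA
  have hA0 : 0 < A := by positivity
  set K₁ : ℝ := C * Λ ^ (n + 2) with hK₁
  have hK₁0 : 0 ≤ K₁ := by positivity
  refine ⟨A * ((1 + 2 * B + 1 / m) * K₁), fun d θ β L hmd hdB hθ hL x => ?_⟩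
  have hd : 0 < d := hm.trans_le hmd
  have ha : 1 / d ^ ((n : ℝ) / 2) ≤ A := by rw [hA]; gcongr
  have ha0 : 0 < 1 / d ^ ((n : ℝ) / 2) := by positivity
  set y := d⁻¹ • L x - x₀ with hy
  have hxy : 1 + ‖x‖ ≤ Λ * (1 + ‖y‖) := by
    have h1 : L x = d • (y + x₀) := by
      rw [hy, sub_add_cancel, smul_smul, mul_inv_cancel₀ hd.ne', one_smul]
    have h2 : ‖x‖ ≤ B * (‖y‖ + ‖x₀‖) := by
      rw [← hL x, h1, norm_smul, Real.norm_of_nonneg hd.le]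
      gcongr
      exact norm_add_le _ _
    have h3 : 0 ≤ B * ‖x₀‖ * ‖y‖ := by positivity
    rw [hΛ]
    nlinarith [norm_nonneg y, norm_nonneg x₀]
  have hpow : ∀ q : ℝ, 0 ≤ q → q * (1 + ‖y‖) ^ (n + 2) ≤ C → q * (1 + ‖x‖) ^ (n + 2) ≤ K₁ := by
    intro q hq hqC
    calc q * (1 + ‖x‖) ^ (n + 2) ≤ q * (Λ * (1 + ‖y‖)) ^ (n + 2) := by gcongr
      _ = q * (1 + ‖y‖) ^ (n + 2) * Λ ^ (n + 2) := by rw [mul_pow]; ring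
      _ ≤ K₁ := by rw [hK₁]; gcongr
  have hQ1 := hpow _ (hQ.pos y).le (hC y).1
  have hQ2 := hpow _ (norm_nonneg _) (hC y).2
  have hone : (1 : ℝ) ≤ 1 + 2 * B + 1 / m := by
    have : 0 < 1 / m := by positivity
    linarith
  constructor
  · rw [norm_quadWave hd hQ.pos, mul_assoc]
    refine mul_le_mul ha (hQ1.trans ?_) ?_ hA0.le
    · exact le_mul_of_one_le_left hK₁0 hone
    · have := (hQ.pos y).le
      positivity
  · have hgrad : ‖cgrad (quadWave Q x₀ d θ β L) x‖ ≤
        A * (2 * B * ‖x‖ * Q y + 1 / m * ‖fderiv ℝ Q y‖) := by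
      have hQy := (hQ.pos y).le
      refine le_trans (b := 1 / d ^ ((n : ℝ) / 2) *
        (2 * |θ| * ‖x‖ * Q y + d⁻¹ * ‖fderiv ℝ Q y‖)) ?_ ?_
      · refine le_of_sq_le_sq ?_ (by positivity)
        rw [norm_cgrad_quadWave_sq hd (hQ.contDiff.of_le (by norm_num)) hL, mul_pow,
          one_div_rpow_half_sq hd]
        refine mul_le_mul_of_nonneg_left ?_ (by positivity)
        have h1 : 0 ≤ 2 * |θ| * ‖x‖ * Q y * (d⁻¹ * ‖fderiv ℝ Q y‖) := by positivity
        have h2 := sq_abs θ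
        rw [← hy, ← h2]
        nlinarith
      · have hd1 : d⁻¹ ≤ 1 / m := by rw [one_div]; gcongr
        gcongr
    have hx1 : ‖x‖ * (1 + ‖x‖) ^ (n + 1) ≤ (1 + ‖x‖) ^ (n + 2) := by
      rw [pow_succ' _ (n + 1)]
      gcongr
      simp
    have hx2 : (1 + ‖x‖) ^ (n + 1) ≤ (1 + ‖x‖) ^ (n + 2) :=
      pow_le_pow_right₀ (by simp) (by norm_num)
    have hQy := (hQ.pos y).le
    calc ‖cgrad (quadWave Q x₀ d θ β L) x‖ * (1 + ‖x‖) ^ (n + 1)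
        ≤ A * (2 * B * ‖x‖ * Q y + 1 / m * ‖fderiv ℝ Q y‖) * (1 + ‖x‖) ^ (n + 1) := by gcongr
      _ = A * (2 * B * (Q y * (‖x‖ * (1 + ‖x‖) ^ (n + 1))) +
            1 / m * (‖fderiv ℝ Q y‖ * (1 + ‖x‖) ^ (n + 1))) := by ring
      _ ≤ A * (2 * B * (Q y * (1 + ‖x‖) ^ (n + 2)) +
            1 / m * (‖fderiv ℝ Q y‖ * (1 + ‖x‖) ^ (n + 2))) := by gcongr
      _ ≤ A * (2 * B * K₁ + 1 / m * K₁) := by gcongr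
      _ ≤ A * ((1 + 2 * B + 1 / m) * K₁) := by
          gcongr
          nlinarith

end

/-! ### The evolution of a modulated ground state -/

section
variable {n : ℕ} {Q : Rn n → ℝ} {x₀ : Rn n} {M : Matrix (Fin n) (Fin n) ℝ}

/-- The modulation equations: scale `D`, quadratic phase `θ` and phase `β` for which `quadWave` solves
the equation with potential strength `γ` on the open time set `I`. Together the first two say
`θ = D'/(4D)` and `D'' = 4γ²D`. -/
structure IsModulation (γ : ℝ) (I : Set ℝ) (D θ β : ℝ → ℝ) : Prop where
  isOpen : IsOpen I
  pos : ∀ t ∈ I, 0 < D t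
  scale : ∀ t ∈ I, HasDerivAt D (4 * θ t * D t) t
  riccati : ∀ t ∈ I, HasDerivAt θ (γ ^ 2 - 4 * θ t ^ 2) t
  phase : ∀ t ∈ I, HasDerivAt β ((D t)⁻¹ ^ 2) t

lemma contDiffOn_of_hasDerivAt {I : Set ℝ} (hI : IsOpen I) {f f' : ℝ → ℝ} {k : ℕ}
    (hf : ∀ t ∈ I, HasDerivAt f (f' t) t) (hf' : ContDiffOn ℝ k f' I) :
    ContDiffOn ℝ (k + 1) f I := by
  rw [contDiffOn_succ_iff_deriv_of_isOpen hI]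
  refine ⟨fun t ht => (hf t ht).differentiableAt.differentiableWithinAt, by simp, ?_⟩
  exact hf'.congr fun t ht => (hf t ht).deriv

namespace IsModulation
variable {γ : ℝ} {I : Set ℝ} {D θ β : ℝ → ℝ}

lemma contDiffOn (h : IsModulation γ I D θ β) :
    ContDiffOn ℝ 2 D I ∧ ContDiffOn ℝ 2 θ I ∧ ContDiffOn ℝ 2 β I := by
  have hD0 : ContDiffOn ℝ (0 : ℕ) D I := contDiffOn_zero.2
    fun t ht => (h.scale t ht).continuousAt.continuousWithinAt
  have hθ0 : ContDiffOn ℝ (0 : ℕ) θ I := contDiffOn_zero.2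
    fun t ht => (h.riccati t ht).continuousAt.continuousWithinAt
  have step : ∀ k : ℕ, ContDiffOn ℝ k D I → ContDiffOn ℝ k θ I →
      ContDiffOn ℝ (k + 1) D I ∧ ContDiffOn ℝ (k + 1) θ I ∧ ContDiffOn ℝ (k + 1) β I := by
    intro k hD hθ
    refine ⟨contDiffOn_of_hasDerivAt h.isOpen h.scale ((contDiffOn_const.mul hθ).mul hD),
      contDiffOn_of_hasDerivAt h.isOpen h.riccati
        (contDiffOn_const.sub (contDiffOn_const.mul (hθ.pow 2))),
      contDiffOn_of_hasDerivAt h.isOpen h.phase ((hD.inv fun t ht => (h.pos t ht).ne').pow 2)⟩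
  -- bootstrap twice through the differential equations
  obtain ⟨hD1, hθ1, -⟩ := step 0 hD0 hθ0
  have := step 1 (by simpa using hD1) (by simpa using hθ1)
  norm_num at this
  exact this

lemma hasDerivAt_quadWave (h : IsModulation γ I D θ β) (hQ : Differentiable ℝ Q) {t : ℝ}
    (ht : t ∈ I) (x : Rn n) :
    HasDerivAt (fun s => quadWave Q x₀ (D s) (θ s) (β s) (matFlow M s) x)
      (((1 / D t ^ ((n : ℝ) / 2) : ℝ) : ℂ) *
        Complex.exp (Complex.I * ((θ t * ‖x‖ ^ 2 + β t : ℝ) : ℂ)) *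
        (Complex.I * ((((γ ^ 2 - 4 * θ t ^ 2) * ‖x‖ ^ 2 + (D t)⁻¹ ^ 2) *
            Q ((D t)⁻¹ • matFlow M t x - x₀) : ℝ) : ℂ)
          + ((-(2 * n * θ t) * Q ((D t)⁻¹ • matFlow M t x - x₀)
            - 4 * θ t * ((D t)⁻¹ * fderiv ℝ Q ((D t)⁻¹ • matFlow M t x - x₀) (matFlow M t x))
            + (D t)⁻¹ * fderiv ℝ Q ((D t)⁻¹ • matFlow M t x - x₀)
              (matFlow M t (matAct M x)) : ℝ) : ℂ))) t := by
  have hpos := h.pos t ht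
  have hinv : HasDerivAt (fun s => (D s)⁻¹) (-(4 * θ t) * (D t)⁻¹) t := by
    refine ((h.scale t ht).inv hpos.ne').congr_deriv ?_
    field_simp
  have ha : HasDerivAt (fun s => 1 / D s ^ ((n : ℝ) / 2))
      (-(2 * n * θ t) * (1 / D t ^ ((n : ℝ) / 2))) t := by
    have h1 := ((h.scale t ht).rpow_const (p := (n : ℝ) / 2) (Or.inl hpos.ne')).inv
      (Real.rpow_pos_of_pos hpos _).ne'
    simp only [one_div]
    refine h1.congr_deriv ?_
    have h3 : D t ^ ((n : ℝ) / 2 - 1) = D t ^ ((n : ℝ) / 2) / D t := by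
      rw [Real.rpow_sub hpos, Real.rpow_one]
    have h4 : D t ^ ((n : ℝ) / 2) ≠ 0 := (Real.rpow_pos_of_pos hpos _).ne'
    rw [h3]
    field_simp
    ring
  have hph := (((((h.riccati t ht).mul_const (‖x‖ ^ 2)).add (h.phase t ht)).ofReal_comp).const_mul
    Complex.I).cexp
  have hy : HasDerivAt (fun s => (D s)⁻¹ • matFlow M s x - x₀)
      ((D t)⁻¹ • matFlow M t (matAct M x) + (-(4 * θ t) * (D t)⁻¹) • matFlow M t x) t :=
    (hinv.smul (hasDerivAt_matFlow M t x)).sub_const x₀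
  have hq := ((hQ _).hasFDerivAt.comp_hasDerivAt t hy).ofReal_comp
  refine ((ha.ofReal_comp.mul hph).mul hq).congr_deriv ?_
  simp only [map_add, map_smul, smul_eq_mul, Pi.add_apply, Function.comp_apply, Pi.mul_apply]
  push_cast
  ring

lemma equation (h : IsModulation γ I D θ β) (hn : 1 ≤ n) (hM : M.transpose = -M)
    (hQ : IsGroundState Q) {t : ℝ} (ht : t ∈ I) (x : Rn n) :
    Complex.I * deriv (fun s => quadWave Q x₀ (D s) (θ s) (β s) (matFlow M s) x) t =
      -(Laplacian.laplacian (quadWave Q x₀ (D t) (θ t) (β t) (matFlow M t)) x)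
        - ((γ ^ 2 * ‖x‖ ^ 2 : ℝ) : ℂ) * quadWave Q x₀ (D t) (θ t) (β t) (matFlow M t) x
        - ((‖quadWave Q x₀ (D t) (θ t) (β t) (matFlow M t) x‖ ^ (4 / (n : ℝ)) : ℝ) : ℂ) *
          quadWave Q x₀ (D t) (θ t) (β t) (matFlow M t) x
        + Complex.I * fderiv ℝ (quadWave Q x₀ (D t) (θ t) (β t) (matFlow M t)) x (matAct M x) := by
  have hpos := h.pos t ht
  have hn0 : (n : ℝ) ≠ 0 := by exact_mod_cast (by omega : n ≠ 0)
  have hQp := hQ.pos ((D t)⁻¹ • matFlow M t x - x₀)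
  rw [(h.hasDerivAt_quadWave hQ.differentiable ht x).deriv,
    laplacian_quadWave hQ.contDiff (norm_matFlow hM t),
    fderiv_quadWave_apply (hQ.contDiff.of_le (by norm_num)), inner_matAct_self hM,
    norm_quadWave hpos hQ.pos]
  have hpow : (1 / D t ^ ((n : ℝ) / 2) * Q ((D t)⁻¹ • matFlow M t x - x₀)) ^ (4 / (n : ℝ)) =
      (D t)⁻¹ ^ 2 * Q ((D t)⁻¹ • matFlow M t x - x₀) ^ (4 / (n : ℝ)) := by
    rw [Real.mul_rpow (by positivity) hQp.le, one_div, Real.inv_rpow (by positivity),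
      ← Real.rpow_mul hpos.le, inv_pow, ← Real.rpow_natCast]
    congr 3
    field_simp
    norm_num
  have heq := hQ.equation ((D t)⁻¹ • matFlow M t x - x₀)
  rw [Real.rpow_add hQp, Real.rpow_one] at heq
  have hlap : Laplacian.laplacian Q ((D t)⁻¹ • matFlow M t x - x₀) =
      Q ((D t)⁻¹ • matFlow M t x - x₀) - Q ((D t)⁻¹ • matFlow M t x - x₀) *
        Q ((D t)⁻¹ • matFlow M t x - x₀) ^ (4 / (n : ℝ)) := by linarith
  rw [hpow, hlap, quadWave]
  push_cast
  linear_combination (1 / ((D t ^ ((n : ℝ) / 2) : ℝ) : ℂ) *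
        Complex.exp (Complex.I * (θ t * (‖x‖ : ℂ) ^ 2 + β t)) *
        (((γ : ℂ) ^ 2 - 4 * (θ t : ℂ) ^ 2) * (‖x‖ : ℂ) ^ 2 + (D t : ℂ)⁻¹ ^ 2) *
        ((Q ((D t)⁻¹ • matFlow M t x - x₀) : ℝ) : ℂ)) * Complex.I_sq

lemma contDiffOn_quadWave (h : IsModulation γ I D θ β) (hQ : ContDiff ℝ 2 Q) :
    ContDiffOn ℝ 2
      (fun z : ℝ × Rn n => quadWave Q x₀ (D z.1) (θ z.1) (β z.1) (matFlow M z.1) z.2)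
      (I ×ˢ univ) := by
  obtain ⟨hD, hθ, hβ⟩ := h.contDiffOn
  have hfst : MapsTo (Prod.fst : ℝ × Rn n → ℝ) (I ×ˢ univ) I := fun z hz => hz.1
  have hD' : ContDiffOn ℝ 2 (fun z : ℝ × Rn n => D z.1) (I ×ˢ univ) :=
    hD.comp contDiff_fst.contDiffOn hfst
  have hθ' : ContDiffOn ℝ 2 (fun z : ℝ × Rn n => θ z.1) (I ×ˢ univ) :=
    hθ.comp contDiff_fst.contDiffOn hfst
  have hβ' : ContDiffOn ℝ 2 (fun z : ℝ × Rn n => β z.1) (I ×ˢ univ) :=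
    hβ.comp contDiff_fst.contDiffOn hfst
  have hpos : ∀ z ∈ I ×ˢ (univ : Set (Rn n)), D z.1 ≠ 0 := fun z hz => (h.pos _ hz.1).ne'
  have ha : ContDiffOn ℝ 2 (fun z : ℝ × Rn n => 1 / D z.1 ^ ((n : ℝ) / 2)) (I ×ˢ univ) :=
    contDiffOn_const.div (hD'.rpow_const_of_ne hpos)
      fun z hz => (Real.rpow_pos_of_pos (h.pos _ hz.1) _).ne'
  have hph : ContDiffOn ℝ 2 (fun z : ℝ × Rn n => θ z.1 * ‖z.2‖ ^ 2 + β z.1) (I ×ˢ univ) :=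
    (hθ'.mul (contDiff_snd.norm_sq ℝ).contDiffOn).add hβ'
  have hflow : ContDiffOn ℝ 2 (fun z : ℝ × Rn n => matFlow M z.1 z.2) (I ×ˢ univ) :=
    (((contDiff_matFlow M).comp contDiff_fst).clm_apply contDiff_snd).contDiffOn
  have hy : ContDiffOn ℝ 2 (fun z : ℝ × Rn n => (D z.1)⁻¹ • matFlow M z.1 z.2 - x₀)
      (I ×ˢ univ) := ((hD'.inv hpos).smul hflow).sub contDiffOn_const
  unfold quadWave
  exact ((Complex.ofRealCLM.contDiff.comp_contDiffOn ha).mul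
    (contDiffOn_const.mul (Complex.ofRealCLM.contDiff.comp_contDiffOn hph)).cexp).mul
      (Complex.ofRealCLM.contDiff.comp_contDiffOn (hQ.comp_contDiffOn hy))

lemma continuousAt_cgrad_quadWave (h : IsModulation γ I D θ β) (hQ : ContDiff ℝ 2 Q) {t : ℝ}
    (ht : t ∈ I) (x : Rn n) :
    ContinuousAt (fun s => cgrad (quadWave Q x₀ (D s) (θ s) (β s) (matFlow M s)) x) t := by
  have hD := (h.scale t ht).continuousAt
  have hθ := (h.riccati t ht).continuousAt
  have hβ := (h.phase t ht).continuousAt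
  have hpos := h.pos t ht
  have hinv : ContinuousAt (fun s => (D s)⁻¹) t := hD.inv₀ hpos.ne'
  have ha : ContinuousAt (fun s => 1 / D s ^ ((n : ℝ) / 2)) t :=
    continuousAt_const.div (hD.rpow_const (Or.inl hpos.ne')) (Real.rpow_pos_of_pos hpos _).ne'
  have hflow : ∀ v : Rn n, ContinuousAt (fun s => matFlow M s v) t :=
    fun v => (hasDerivAt_matFlow M t v).continuousAt
  have hy : ContinuousAt (fun s => (D s)⁻¹ • matFlow M s x - x₀) t :=
    (hinv.smul (hflow x)).sub continuousAt_const
  have hq : ContinuousAt (fun s => Q ((D s)⁻¹ • matFlow M s x - x₀)) t :=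
    ContinuousAt.comp (f := fun s => (D s)⁻¹ • matFlow M s x - x₀)
      hQ.continuous.continuousAt hy
  have hdq : ContinuousAt (fun s => fderiv ℝ Q ((D s)⁻¹ • matFlow M s x - x₀)) t :=
    ContinuousAt.comp (f := fun s => (D s)⁻¹ • matFlow M s x - x₀)
      (hQ.continuous_fderiv (by norm_num)).continuousAt hy
  unfold cgrad
  refine (PiLp.continuous_toLp 2 _).continuousAt.comp (continuousAt_pi.2 fun j => ?_)
  simp only [fderiv_quadWave_apply (hQ.of_le (by norm_num : (1 : WithTop ℕ∞) ≤ 2))]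
  have hR : ∀ {f : ℝ → ℝ}, ContinuousAt f t → ContinuousAt (fun s => (f s : ℂ)) t :=
    fun hf => Complex.continuous_ofReal.continuousAt.comp hf
  refine ((hR ha).mul (Complex.continuous_exp.continuousAt.comp
    (continuousAt_const.mul (hR ((hθ.mul continuousAt_const).add hβ))))).mul
    ((continuousAt_const.mul (hR (((continuousAt_const.mul hθ).mul continuousAt_const).mul hq))).add
      (hR (hinv.mul (hdq.clm_apply (hflow _)))))

/-- Near a given time the parameters stay in a compact range, on which the decay is uniform. -/
lemma eventually_sigmaDecay (h : IsModulation γ I D θ β) (hn : 1 ≤ n) (hM : M.transpose = -M)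
    (hQ : IsGroundState Q) {t : ℝ} (ht : t ∈ I) :
    ∃ K, ∀ᶠ s in 𝓝 t, SigmaDecay K (quadWave Q x₀ (D s) (θ s) (β s) (matFlow M s)) := by
  have hpos := h.pos t ht
  obtain ⟨K, hK⟩ := hQ.exists_sigmaDecay_quadWave hn x₀ (half_pos hpos)
    (B := D t + |θ t| + 1) (by positivity)
  have hD := (h.scale t ht).continuousAt
  have hθ := (h.riccati t ht).continuousAt.abs
  refine ⟨K, ?_⟩
  filter_upwards [hD.eventually_const_lt (half_lt_self hpos),
    hD.eventually_lt_const (show D t < D t + |θ t| + 1 by linarith [abs_nonneg (θ t)]),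
    hθ.eventually_lt_const (show |θ t| < D t + |θ t| + 1 by linarith)] with s h1 h2 h3
  exact hK _ _ _ _ h1.le h2.le h3.le (norm_matFlow hM s)

/-- The ansatz: a modulated ground state solves the rotational equation. -/
theorem isSolutionRNLS (h : IsModulation γ I D θ β) (hn : 1 ≤ n) (hM : M.transpose = -M)
    (hQ : IsGroundState Q) :
    IsSolutionRNLS γ M I (fun t => quadWave Q x₀ (D t) (θ t) (β t) (matFlow M t)) where
  continuous := continuousInSigma_of_sigmaDecay
    (fun t _ => contDiff_quadWave (hQ.contDiff.of_le (by norm_num)))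
    (fun t ht => (h.eventually_sigmaDecay hn hM hQ ht).imp
      fun K hK => hK.filter_mono nhdsWithin_le_nhds)
    (fun t ht x => (h.hasDerivAt_quadWave hQ.differentiable ht x).continuousAt.continuousWithinAt)
    (fun t ht x => (h.continuousAt_cgrad_quadWave hQ.contDiff ht x).continuousWithinAt)
  contDiffOn := h.contDiffOn_quadWave hQ.contDiff
  equation := fun t ht x => h.equation hn hM hQ ht x

end IsModulation
end

/-! ### The mass and the gradient norm -/

section
variable {n : ℕ} {Q : Rn n → ℝ} {x₀ : Rn n} {d θ β : ℝ} {L : Rn n →L[ℝ] Rn n}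

lemma eLpNorm_two_toReal_sq {E : Type*} [NormedAddCommGroup E] {f : Rn n → E}
    (hf : MemLp f 2 volume) : (eLpNorm f 2 volume).toReal ^ 2 = ∫ x, ‖f x‖ ^ 2 := by
  have h0 : 0 ≤ ∫ x, ‖f x‖ ^ 2 := integral_nonneg fun x => by positivity
  rw [hf.eLpNorm_eq_integral_rpow_norm (by norm_num) (by norm_num)]
  simp only [ENNReal.toReal_ofNat, Real.rpow_ofNat]
  rw [ENNReal.toReal_ofReal (by positivity), ← Real.rpow_natCast, ← Real.rpow_mul h0]
  norm_num

lemma gradNorm_nonneg (f : Rn n → ℂ) : 0 ≤ gradNorm f := ENNReal.toReal_nonneg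

lemma eLpNorm_quadWave (hd : 0 < d) (hL : ∀ x, ‖L x‖ = ‖x‖) (hQ : IsGroundState Q)
    (hw : MemLp (quadWave Q x₀ d θ β L) 2 volume) :
    eLpNorm (quadWave Q x₀ d θ β L) 2 volume = eLpNorm Q 2 volume := by
  rw [← ENNReal.toReal_eq_toReal_iff' hw.2.ne hQ.memLp.2.ne,
    ← sq_eq_sq₀ ENNReal.toReal_nonneg ENNReal.toReal_nonneg, eLpNorm_two_toReal_sq hw,
    eLpNorm_two_toReal_sq hQ.memLp]
  simp only [norm_quadWave hd hQ.pos, mul_pow, one_div_rpow_half_sq hd]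
  rw [integral_const_mul, integral_comp_affine hd hL (fun y => Q y ^ 2), ← mul_assoc]
  simp [hd.ne']

lemma integral_pos_of_continuous {f : Rn n → ℝ} (hf : Continuous f) (h0 : ∀ x, 0 ≤ f x)
    (hi : Integrable f volume) {x : Rn n} (hx : f x ≠ 0) : 0 < ∫ y, f y := by
  rw [integral_pos_iff_support_of_nonneg h0 hi]
  exact hf.isOpen_support.measure_pos volume ⟨x, hx⟩

/-- The second moment of the density `Q²` about the point `-x₀`. -/
noncomputable def shiftedMoment (Q : Rn n → ℝ) (x₀ : Rn n) : ℝ := ∫ y, ‖y + x₀‖ ^ 2 * Q y ^ 2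

/-- The Dirichlet integral `‖∇Q‖₂²`. -/
noncomputable def dirichletIntegral (Q : Rn n → ℝ) : ℝ := ∫ y, ‖fderiv ℝ Q y‖ ^ 2

namespace IsGroundState

lemma integrable_moment (hn : 1 ≤ n) (hQ : IsGroundState Q) (x₀ : Rn n) :
    Integrable (fun y => ‖y + x₀‖ ^ 2 * Q y ^ 2) volume := by
  obtain ⟨C, hC0, hC⟩ := hQ.poly_decay hn (n + 2)
  have hcont : Continuous fun y => ‖y + x₀‖ * Q y :=
    (continuous_id.add continuous_const).norm.mul hQ.contDiff.continuous
  have h : MemLp (fun y => ‖y + x₀‖ * Q y) 2 volume := by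
    refine (memLp_two_inv_one_add_norm_pow ((1 + ‖x₀‖) * C)).mono' hcont.aestronglyMeasurable
      (Eventually.of_forall fun y => ?_)
    have hQy := (hQ.pos y).le
    rw [Real.norm_of_nonneg (by positivity), le_div_iff₀ (by positivity)]
    have h1 : ‖y + x₀‖ ≤ (1 + ‖x₀‖) * (1 + ‖y‖) := by
      have := norm_add_le y x₀
      nlinarith [norm_nonneg y, norm_nonneg x₀, mul_nonneg (norm_nonneg y) (norm_nonneg x₀)]
    calc ‖y + x₀‖ * Q y * (1 + ‖y‖) ^ (n + 1)
        ≤ (1 + ‖x₀‖) * (1 + ‖y‖) * Q y * (1 + ‖y‖) ^ (n + 1) := by gcongr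
      _ = (1 + ‖x₀‖) * (Q y * (1 + ‖y‖) ^ (n + 2)) := by ring
      _ ≤ (1 + ‖x₀‖) * C := by gcongr; exact (hC y).1
  simpa [mul_pow] using (memLp_two_iff_integrable_sq hcont.aestronglyMeasurable).1 h

lemma integrable_norm_fderiv_sq (hQ : IsGroundState Q) :
    Integrable (fun y => ‖fderiv ℝ Q y‖ ^ 2) volume :=
  (memLp_two_iff_integrable_sq_norm hQ.memLp_grad.1).1 hQ.memLp_grad

lemma shiftedMoment_pos (hn : 1 ≤ n) (hQ : IsGroundState Q) (x₀ : Rn n) :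
    0 < shiftedMoment Q x₀ := by
  have hQc := hQ.contDiff.continuous
  refine integral_pos_of_continuous (x := -x₀ + EuclideanSpace.single ⟨0, hn⟩ 1) (by fun_prop)
    (fun y => by positivity) (hQ.integrable_moment hn x₀) ?_
  have := hQ.pos (-x₀ + EuclideanSpace.single ⟨0, hn⟩ 1)
  rw [neg_add_cancel_comm]
  simp [this.ne']

lemma dirichletIntegral_pos (hn : 1 ≤ n) (hQ : IsGroundState Q) : 0 < dirichletIntegral Q := by
  obtain ⟨x, hx⟩ : ∃ x, fderiv ℝ Q x ≠ 0 := by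
    by_contra! hcon
    obtain ⟨y, hy⟩ := hQ.exists_lt hn (hQ.pos 0)
    exact hy.ne (is_const_of_fderiv_eq_zero hQ.differentiable hcon y 0)
  have hc : Continuous (fderiv ℝ Q) := hQ.contDiff.continuous_fderiv (by norm_num)
  refine integral_pos_of_continuous (x := x) (by fun_prop) (fun y => by positivity)
    hQ.integrable_norm_fderiv_sq ?_
  simpa using hx

end IsGroundState

lemma gradNorm_quadWave_sq (hn : 1 ≤ n) (hd : 0 < d) (hL : ∀ x, ‖L x‖ = ‖x‖)
    (hQ : IsGroundState Q) (hw : MemLp (cgrad (quadWave Q x₀ d θ β L)) 2 volume) :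
    gradNorm (quadWave Q x₀ d θ β L) ^ 2 =
      4 * θ ^ 2 * d ^ 2 * shiftedMoment Q x₀ + d⁻¹ ^ 2 * dirichletIntegral Q := by
  rw [gradNorm, eLpNorm_two_toReal_sq hw]
  simp only [norm_cgrad_quadWave_sq hd (hQ.contDiff.of_le (by norm_num : (1 : WithTop ℕ∞) ≤ 2)) hL]
  rw [integral_const_mul]
  have hx : ∀ x, ‖x‖ ^ 2 = d ^ 2 * ‖d⁻¹ • L x - x₀ + x₀‖ ^ 2 := fun x => by
    rw [sub_add_cancel, norm_smul, hL, norm_inv, Real.norm_of_nonneg hd.le]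
    field_simp
  have hF : (fun x => 4 * θ ^ 2 * ‖x‖ ^ 2 * Q (d⁻¹ • L x - x₀) ^ 2 +
      d⁻¹ ^ 2 * ‖fderiv ℝ Q (d⁻¹ • L x - x₀)‖ ^ 2) =
      fun x => (fun y => 4 * θ ^ 2 * (d ^ 2 * ‖y + x₀‖ ^ 2) * Q y ^ 2 +
        d⁻¹ ^ 2 * ‖fderiv ℝ Q y‖ ^ 2) (d⁻¹ • L x - x₀) := funext fun x => by
    exact congrArg (fun r => 4 * θ ^ 2 * r * Q (d⁻¹ • L x - x₀) ^ 2 +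
      d⁻¹ ^ 2 * ‖fderiv ℝ Q (d⁻¹ • L x - x₀)‖ ^ 2) (hx x)
  rw [hF, integral_comp_affine hd hL (fun y => 4 * θ ^ 2 * (d ^ 2 * ‖y + x₀‖ ^ 2) * Q y ^ 2 +
    d⁻¹ ^ 2 * ‖fderiv ℝ Q y‖ ^ 2), ← mul_assoc, one_div, inv_mul_cancel₀ (by positivity),
    one_mul]
  have h1 : ∀ y, 4 * θ ^ 2 * (d ^ 2 * ‖y + x₀‖ ^ 2) * Q y ^ 2 =
      4 * θ ^ 2 * d ^ 2 * (‖y + x₀‖ ^ 2 * Q y ^ 2) := fun y => by ring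
  simp only [h1]
  rw [integral_add ((hQ.integrable_moment hn x₀).const_mul _)
    (hQ.integrable_norm_fderiv_sq.const_mul _), integral_const_mul, integral_const_mul]
  rfl

end

/-! ### The two waves and the blowup rate -/

section
variable {n : ℕ} {Q : Rn n → ℝ} {x₀ : Rn n} {M : Matrix (Fin n) (Fin n) ℝ} {T γ : ℝ}

lemma minimalMass_eq_quadWave (Q : Rn n → ℝ) (T : ℝ) (x₀ : Rn n) (t : ℝ) :
    minimalMass Q T x₀ t =
      quadWave Q x₀ (T - t) (-(1 / (4 * (T - t)))) (1 / (T - t)) (matFlow 0 t) := by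
  have hflow : ∀ x : Rn n, matFlow (0 : Matrix (Fin n) (Fin n) ℝ) t x = x := fun x => by
    have h1 : t • (0 : Matrix (Fin n) (Fin n) ℝ) = 0 := smul_zero t
    rw [matFlow, h1, NormedSpace.exp_zero, map_one]
    rfl
  funext x
  rw [minimalMass, quadWave, hflow, mul_assoc (Complex.ofReal _), ← Complex.exp_add,
    one_div (T - t)]
  congr 3
  push_cast
  ring

lemma isModulation_minimalMass (T : ℝ) :
    IsModulation 0 (Iio T) (fun t => T - t) (fun t => -(1 / (4 * (T - t))))
      (fun t => 1 / (T - t)) where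
  isOpen := isOpen_Iio
  pos := fun t ht => sub_pos.2 ht
  scale := fun t ht => by
    have h0 : T - t ≠ 0 := (sub_pos.2 ht).ne'
    refine ((hasDerivAt_id t).const_sub T).congr_deriv ?_
    field_simp
  riccati := fun t ht => by
    have h0 : T - t ≠ 0 := (sub_pos.2 ht).ne'
    simp only [one_div]
    refine ((((hasDerivAt_id t).const_sub T).const_mul 4).inv (by simpa using h0)).neg.congr_deriv
      ?_
    simp only [id]
    field_simp
    ring
  phase := fun t ht => by
    have h0 : T - t ≠ 0 := (sub_pos.2 ht).ne'
    simp only [one_div]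
    refine (((hasDerivAt_id t).const_sub T).inv h0).congr_deriv ?_
    simp only [id]
    field_simp

/-- The scale `T cosh(2γt) - sinh(2γt)/(2γ)` of the transformed wave. -/
noncomputable def hypScale (γ T t : ℝ) : ℝ :=
  T * Real.cosh (2 * γ * t) - Real.sinh (2 * γ * t) / (2 * γ)

/-- The time derivative of `hypScale`. -/
noncomputable def hypScaleDeriv (γ T t : ℝ) : ℝ :=
  2 * γ * T * Real.sinh (2 * γ * t) - Real.cosh (2 * γ * t)

/-- The condition on `γ` says that `tanh(2γt)/(2γ)` never reaches `T`; this is where it enters. -/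
lemma exp_le_hypScale (hγT : -(1 / (2 * γ)) ≤ T) (t : ℝ) :
    -(1 / (2 * γ)) * Real.exp (2 * γ * t) ≤ hypScale γ T t := by
  have h1 := mul_le_mul_of_nonneg_right hγT (Real.cosh_pos (2 * γ * t)).le
  rw [← Real.cosh_add_sinh, hypScale]
  have h2 : Real.sinh (2 * γ * t) / (2 * γ) = 1 / (2 * γ) * Real.sinh (2 * γ * t) := by ring
  rw [h2]
  linarith

lemma hypScale_pos (hγ0 : γ < 0) (hγT : -(1 / (2 * γ)) ≤ T) (t : ℝ) : 0 < hypScale γ T t := by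
  refine lt_of_lt_of_le ?_ (exp_le_hypScale hγT t)
  have : 0 < -(1 / (2 * γ)) := by
    rw [neg_pos]
    exact one_div_neg.2 (by linarith)
  positivity

lemma isModulation_Rtransform (hγ0 : γ < 0) (hγT : -(1 / (2 * γ)) ≤ T) :
    IsModulation γ univ (hypScale γ T) (fun t => hypScaleDeriv γ T t / (4 * hypScale γ T t))
      (fun t => Real.cosh (2 * γ * t) / hypScale γ T t) := by
  have hlin : ∀ t, HasDerivAt (fun t => 2 * γ * t) (2 * γ) t := fun t => by
    simpa using (hasDerivAt_id t).const_mul (2 * γ)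
  have hD : ∀ t, HasDerivAt (hypScale γ T) (hypScaleDeriv γ T t) t := fun t => by
    refine (((hlin t).cosh.const_mul T).sub ((hlin t).sinh.div_const (2 * γ))).congr_deriv ?_
    have := hγ0.ne
    rw [hypScaleDeriv]
    field_simp
  have hD1 : ∀ t, HasDerivAt (hypScaleDeriv γ T) (4 * γ ^ 2 * hypScale γ T t) t := fun t => by
    refine (((hlin t).sinh.const_mul (2 * γ * T)).sub (hlin t).cosh).congr_deriv ?_
    have := hγ0.ne
    rw [hypScale]
    field_simp
    ring
  have h0 : ∀ t, hypScale γ T t ≠ 0 := fun t => (hypScale_pos hγ0 hγT t).ne'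
  refine ⟨isOpen_univ, fun t _ => hypScale_pos hγ0 hγT t, fun t _ => ?_, fun t _ => ?_,
    fun t _ => ?_⟩
  · refine (hD t).congr_deriv ?_
    have := h0 t
    field_simp
  · refine ((hD1 t).div ((hD t).const_mul 4) (mul_ne_zero (by norm_num) (h0 t))).congr_deriv ?_
    have := h0 t
    field_simp
  · refine ((hlin t).cosh.div (hD t) (h0 t)).congr_deriv ?_
    have h1 := h0 t
    have hcs := Real.cosh_sq_sub_sinh_sq (2 * γ * t)
    have hnum : Real.sinh (2 * γ * t) * (2 * γ) * hypScale γ T t -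
        Real.cosh (2 * γ * t) * hypScaleDeriv γ T t = 1 := by
      have := hγ0.ne
      rw [hypScale, hypScaleDeriv, ← hcs]
      field_simp
      ring
    rw [hnum, one_div, inv_pow]

lemma Rtransform_minimalMass_eq_quadWave (hM : M.transpose = -M) (hγ0 : γ < 0)
    (hγT : -(1 / (2 * γ)) ≤ T) (Q : Rn n → ℝ) (x₀ : Rn n) (t : ℝ) :
    Rtransform γ M (minimalMass Q T x₀) t =
      quadWave Q x₀ (hypScale γ T t) (hypScaleDeriv γ T t / (4 * hypScale γ T t))
        (Real.cosh (2 * γ * t) / hypScale γ T t) (matFlow M t) := by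
  funext x
  have hcs := Real.cosh_sq_sub_sinh_sq (2 * γ * t)
  have hC := Real.cosh_pos (2 * γ * t)
  have hD := hypScale_pos hγ0 hγT t
  have hsub : T - Real.tanh (2 * γ * t) / (2 * γ) = hypScale γ T t / Real.cosh (2 * γ * t) := by
    have := hγ0.ne
    rw [Real.tanh_eq_sinh_div_cosh, hypScale]
    field_simp
  have hθ : hypScaleDeriv γ T t / (4 * hypScale γ T t) =
      γ / 2 * Real.tanh (2 * γ * t) - 1 / (4 * Real.cosh (2 * γ * t) * hypScale γ T t) := by
    have h1 : Real.cosh (2 * γ * t) * hypScaleDeriv γ T t =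
        2 * γ * Real.sinh (2 * γ * t) * hypScale γ T t - 1 := by
      have := hγ0.ne
      rw [hypScale, hypScaleDeriv, ← hcs]
      field_simp
      ring
    rw [Real.tanh_eq_sinh_div_cosh]
    generalize Real.cosh (2 * γ * t) = C at h1 hC ⊢
    generalize Real.sinh (2 * γ * t) = S at h1 ⊢
    field_simp
    linarith
  simp only [Rtransform, minimalMass, hsub, ← matFlow_apply]
  have hamp : ((1 / hypScale γ T t ^ ((n : ℝ) / 2) : ℝ) : ℂ) =
      ((1 / Real.cosh (2 * γ * t) ^ ((n : ℝ) / 2) : ℝ) : ℂ) *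
        ((1 / (hypScale γ T t / Real.cosh (2 * γ * t)) ^ ((n : ℝ) / 2) : ℝ) : ℂ) := by
    rw [← Complex.ofReal_mul, Real.div_rpow hD.le hC.le]
    congr 1
    have := Real.rpow_pos_of_pos hC ((n : ℝ) / 2)
    field_simp
  have harg : (1 / (hypScale γ T t / Real.cosh (2 * γ * t))) •
      (1 / Real.cosh (2 * γ * t)) • matFlow M t x = (hypScale γ T t)⁻¹ • matFlow M t x := by
    rw [smul_smul]
    congr 1
    field_simp
  have hnorm : ‖(1 / Real.cosh (2 * γ * t)) • matFlow M t x‖ ^ 2 /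
      (4 * (hypScale γ T t / Real.cosh (2 * γ * t))) =
      1 / (4 * Real.cosh (2 * γ * t) * hypScale γ T t) * ‖x‖ ^ 2 := by
    rw [norm_smul, norm_matFlow hM, Real.norm_of_nonneg (by positivity)]
    field_simp
  have hphase : Complex.exp (Complex.I * ((hypScaleDeriv γ T t / (4 * hypScale γ T t) * ‖x‖ ^ 2 +
        Real.cosh (2 * γ * t) / hypScale γ T t : ℝ) : ℂ)) =
      Complex.exp (Complex.I * ((γ / 2 * ‖x‖ ^ 2 * Real.tanh (2 * γ * t) : ℝ) : ℂ)) *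
      Complex.exp (-(Complex.I *
        ((1 / (4 * Real.cosh (2 * γ * t) * hypScale γ T t) * ‖x‖ ^ 2 : ℝ) : ℂ))) *
      Complex.exp (Complex.I * ((1 / (hypScale γ T t / Real.cosh (2 * γ * t)) : ℝ) : ℂ)) := by
    rw [← Complex.exp_add, ← Complex.exp_add, hθ, one_div_div]
    congr 1
    push_cast
    ring
  rw [hnorm, harg, quadWave, hamp, hphase]
  ring

lemma gradNorm_minimalMass_sq (hn : 1 ≤ n) (hQ : IsGroundState Q) {t : ℝ} (ht : t < T) :
    gradNorm (minimalMass Q T x₀ t) ^ 2 =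
      1 / 4 * shiftedMoment Q x₀ + (T - t)⁻¹ ^ 2 * dirichletIntegral Q := by
  have hM : (0 : Matrix (Fin n) (Fin n) ℝ).transpose = -0 := by simp
  have hsol := (isModulation_minimalMass T).isSolutionRNLS (x₀ := x₀) hn hM hQ
  have h0 : T - t ≠ 0 := (sub_pos.2 ht).ne'
  rw [minimalMass_eq_quadWave, gradNorm_quadWave_sq hn (sub_pos.2 ht) (norm_matFlow hM t) hQ
    (hsol.continuous t ht).1.memLp_grad]
  congr 2
  field_simp

lemma gradNorm_Rtransform_sq (hn : 1 ≤ n) (hM : M.transpose = -M) (hγ0 : γ < 0)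
    (hγT : -(1 / (2 * γ)) ≤ T) (hQ : IsGroundState Q) (x₀ : Rn n) (t : ℝ) :
    gradNorm (Rtransform γ M (minimalMass Q T x₀) t) ^ 2 =
      1 / 4 * hypScaleDeriv γ T t ^ 2 * shiftedMoment Q x₀ +
        (hypScale γ T t)⁻¹ ^ 2 * dirichletIntegral Q := by
  have hsol := (isModulation_Rtransform hγ0 hγT).isSolutionRNLS (x₀ := x₀) hn hM hQ
  have hD := hypScale_pos hγ0 hγT t
  rw [Rtransform_minimalMass_eq_quadWave hM hγ0 hγT, gradNorm_quadWave_sq hn hD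
    (norm_matFlow hM t) hQ (hsol.continuous t (mem_univ t)).1.memLp_grad]
  congr 2
  field_simp

lemma tendsto_gradNorm_minimalMass (hn : 1 ≤ n) (hQ : IsGroundState Q) :
    Tendsto (fun t => gradNorm (minimalMass Q T x₀ t)) (𝓝[<] T) atTop := by
  have hB := hQ.dirichletIntegral_pos hn
  have hA := hQ.shiftedMoment_pos hn x₀
  have hsub : Tendsto (fun t => T - t) (𝓝[<] T) (𝓝[>] 0) := by
    refine tendsto_nhdsWithin_iff.2 ⟨?_, ?_⟩
    · have : Tendsto (fun t => T - t) (𝓝 T) (𝓝 (T - T)) := tendsto_const_nhds.sub tendsto_id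
      rw [sub_self] at this
      exact this.mono_left nhdsWithin_le_nhds
    · filter_upwards [self_mem_nhdsWithin] with t ht using sub_pos.2 (mem_Iio.1 ht)
  have hlim : Tendsto (fun t => √(dirichletIntegral Q) * (T - t)⁻¹) (𝓝[<] T) atTop :=
    (tendsto_inv_nhdsGT_zero.comp hsub).const_mul_atTop (Real.sqrt_pos.2 hB)
  refine tendsto_atTop_mono' _ ?_ hlim
  filter_upwards [self_mem_nhdsWithin] with t ht
  refine le_of_sq_le_sq ?_ (gradNorm_nonneg _)
  rw [gradNorm_minimalMass_sq hn hQ ht, mul_pow, Real.sq_sqrt hB.le]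
  nlinarith

lemma exists_gradNorm_Rtransform_le (hn : 1 ≤ n) (hM : M.transpose = -M) (hT : 0 < T)
    (hγ0 : γ < 0) (hγT : -(1 / (2 * γ)) ≤ T) (hQ : IsGroundState Q) (x₀ : Rn n) :
    ∃ K, ∀ t, 0 ≤ t →
      gradNorm (Rtransform γ M (minimalMass Q T x₀) t) ≤ K * Real.exp (-(2 * γ * t)) := by
  have hB := hQ.dirichletIntegral_pos hn
  have hA := hQ.shiftedMoment_pos hn x₀
  refine ⟨√(1 / 4 * (-(2 * γ) * T + 1) ^ 2 * shiftedMoment Q x₀ +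
    (-(2 * γ)) ^ 2 * dirichletIntegral Q), fun t ht => ?_⟩
  set E := Real.exp (-(2 * γ * t)) with hE
  have hE0 : 0 < E := Real.exp_pos _
  have hle : Real.exp (2 * γ * t) ≤ E := by
    rw [hE]; gcongr; nlinarith
  have hcosh : Real.cosh (2 * γ * t) ≤ E := by rw [Real.cosh_eq, ← hE]; linarith
  have hsinh : |Real.sinh (2 * γ * t)| ≤ E := by
    rw [Real.sinh_eq, ← hE, abs_le]
    constructor <;> linarith [Real.exp_pos (2 * γ * t)]
  have hD1 : |hypScaleDeriv γ T t| ≤ (-(2 * γ) * T + 1) * E := by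
    have hg : 0 < -(2 * γ) * T := by
      have : 0 < -(2 * γ) := by linarith
      positivity
    rw [hypScaleDeriv]
    refine (abs_sub _ _).trans ?_
    rw [abs_mul, abs_of_neg (show 2 * γ * T < 0 by linarith),
      abs_of_pos (Real.cosh_pos (2 * γ * t))]
    nlinarith
  have hDinv : (hypScale γ T t)⁻¹ ≤ -(2 * γ) * E := by
    have h1 := exp_le_hypScale hγT t
    have h2 : -(1 / (2 * γ)) * Real.exp (2 * γ * t) = (-(2 * γ) * E)⁻¹ := by
      rw [hE, Real.exp_neg, mul_inv, inv_inv, inv_neg, one_div]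
    rw [h2] at h1
    have h3 : 0 < -(2 * γ) * E := mul_pos (by linarith) hE0
    exact inv_le_of_inv_le₀ h3 h1
  have hDpos := inv_pos.2 (hypScale_pos hγ0 hγT t)
  refine le_of_sq_le_sq ?_ (by positivity)
  rw [gradNorm_Rtransform_sq hn hM hγ0 hγT hQ, mul_pow, Real.sq_sqrt (by positivity)]
  have h1 : hypScaleDeriv γ T t ^ 2 ≤ ((-(2 * γ) * T + 1) * E) ^ 2 := by
    rw [← sq_abs (hypScaleDeriv γ T t)]
    gcongr
  have h2 : (hypScale γ T t)⁻¹ ^ 2 ≤ (-(2 * γ) * E) ^ 2 := by gcongr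
  calc _ ≤ 1 / 4 * ((-(2 * γ) * T + 1) * E) ^ 2 * shiftedMoment Q x₀ +
        (-(2 * γ) * E) ^ 2 * dirichletIntegral Q := by gcongr
    _ = _ := by ring

/-- If `-2γT = 1` the scale decays like `exp (2γt)` and the Dirichlet term is large; otherwise the
scale grows like `exp (-2γt)` and the moment term is large. -/
lemma exists_le_gradNorm_Rtransform (hn : 1 ≤ n) (hM : M.transpose = -M)
    (hγ0 : γ < 0) (hγT : -(1 / (2 * γ)) ≤ T) (hQ : IsGroundState Q) (x₀ : Rn n) :
    ∃ κ, 0 < κ ∧ ∀ᶠ t in atTop,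
      κ * Real.exp (-(2 * γ * t)) ≤ gradNorm (Rtransform γ M (minimalMass Q T x₀) t) := by
  have hB := hQ.dirichletIntegral_pos hn
  have hA := hQ.shiftedMoment_pos hn x₀
  have hg : 0 < -(2 * γ) := by linarith
  rcases hγT.eq_or_lt with heq | hlt
  · refine ⟨√(dirichletIntegral Q) * -(2 * γ), by positivity, Eventually.of_forall fun t => ?_⟩
    have hD : (hypScale γ T t)⁻¹ = -(2 * γ) * Real.exp (-(2 * γ * t)) := by
      rw [hypScale, ← heq, Real.exp_neg, ← Real.cosh_add_sinh, ← inv_inv (-(2 * γ)), ← mul_inv,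
        inv_neg]
      congr 1
      ring
    refine le_of_sq_le_sq ?_ (gradNorm_nonneg _)
    rw [gradNorm_Rtransform_sq hn hM hγ0 hγT hQ, hD, mul_assoc, mul_pow, Real.sq_sqrt hB.le]
    nlinarith [mul_nonneg (sq_nonneg (hypScaleDeriv γ T t)) hA.le]
  · set a := -(2 * γ) * T with ha
    have ha1 : 1 < a := by
      rw [ha]
      have h := mul_lt_mul_of_pos_left hlt hg
      have h2 : -(2 * γ) * -(1 / (2 * γ)) = 1 := by
        have := hγ0.ne
        field_simp
      linarith
    refine ⟨√(shiftedMoment Q x₀) * ((a - 1) / 8), ?_, ?_⟩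
    · have : 0 < (a - 1) / 8 := by linarith
      positivity
    have hlim : Tendsto (fun t => Real.exp (-(2 * γ * t))) atTop atTop := by
      refine Real.tendsto_exp_atTop.comp ?_
      have : (fun t => -(2 * γ * t)) = fun t => -(2 * γ) * t := by funext t; ring
      rw [this]
      exact tendsto_id.const_mul_atTop hg
    filter_upwards [hlim.eventually_ge_atTop (max 1 (2 * (a + 1) / (a - 1)))] with t ht
    set E := Real.exp (-(2 * γ * t)) with hE
    have hE1 : 1 ≤ E := (le_max_left _ _).trans ht
    have hE2 : 2 * (a + 1) ≤ E * (a - 1) :=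
      (div_le_iff₀ (by linarith)).1 ((le_max_right _ _).trans ht)
    have hinv : Real.exp (2 * γ * t) ≤ 1 := by
      have : Real.exp (2 * γ * t) = E⁻¹ := by rw [hE, Real.exp_neg, inv_inv]
      rw [this]
      exact inv_le_one_of_one_le₀ hE1
    have hD1 : (a - 1) / 4 * E ≤ hypScaleDeriv γ T t := by
      have h1 : hypScaleDeriv γ T t = (a - 1) / 2 * E - (a + 1) / 2 * Real.exp (2 * γ * t) := by
        rw [hypScaleDeriv, Real.sinh_eq, Real.cosh_eq, ← hE, ha]
        ring
      rw [h1]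
      nlinarith
    have hD0 : 0 ≤ (a - 1) / 4 * E := mul_nonneg (by linarith) (by linarith)
    have hsq : ((a - 1) / 4 * E) ^ 2 ≤ hypScaleDeriv γ T t ^ 2 := by gcongr
    refine le_of_sq_le_sq ?_ (gradNorm_nonneg _)
    rw [gradNorm_Rtransform_sq hn hM hγ0 hγT hQ, mul_assoc, mul_pow, Real.sq_sqrt hA.le]
    have h2 := mul_le_mul_of_nonneg_right hsq hA.le
    have h3 : 0 ≤ (hypScale γ T t)⁻¹ ^ 2 * dirichletIntegral Q := by positivity
    nlinarith

end

theorem corollary4p5 (n : ℕ) (hn : 1 ≤ n) (M : Matrix (Fin n) (Fin n) ℝ)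
    (hM : M.transpose = -M) (T γ : ℝ) (hT : 0 < T) (hγ : γ ≤ -(1 / (2 * T)))
    (Q : Rn n → ℝ) (hQ : IsGroundState Q) (x₀ : Rn n) :
    -- the profile is a minimal-mass solution of NLS that blows up exactly at time `T`
    (IsSolutionNLS (Iio T) (minimalMass Q T x₀) ∧
      (∀ t < T, eLpNorm (minimalMass Q T x₀ t) 2 volume = eLpNorm Q 2 volume) ∧
      Tendsto (fun t => gradNorm (minimalMass Q T x₀ t)) (𝓝[<] T) atTop) ∧
    -- its transform is a global solution of RNLS
    IsSolutionRNLS γ M univ (Rtransform γ M (minimalMass Q T x₀)) ∧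
    -- the gradient blows up at infinite time, at the exact exponential rate
    Tendsto (fun t => gradNorm (Rtransform γ M (minimalMass Q T x₀) t)) atTop atTop ∧
    (fun t => gradNorm (Rtransform γ M (minimalMass Q T x₀) t))
      =O[atTop] (fun t => Real.exp (2 * |γ| * t)) ∧
    (fun t => Real.exp (2 * |γ| * t))
      =O[atTop] (fun t => gradNorm (Rtransform γ M (minimalMass Q T x₀) t)) := by
  have hγ0 : γ < 0 := by
    have : 0 < 1 / (2 * T) := by positivity
    linarith
  have hγT : -(1 / (2 * γ)) ≤ T := by
    have h := mul_le_mul_of_nonneg_left hγ (show (0 : ℝ) ≤ 2 * T by positivity)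
    rw [mul_neg, mul_one_div_cancel (by positivity)] at h
    have h2 : -(1 / (2 * γ)) = 1 / (2 * -γ) := by rw [mul_neg, one_div_neg_eq_neg_one_div]
    rw [h2, div_le_iff₀ (by linarith)]
    linarith
  have hM0 : (0 : Matrix (Fin n) (Fin n) ℝ).transpose = -0 := by simp
  have hφ : IsSolutionNLS (Iio T) (minimalMass Q T x₀) := by
    have h := (isModulation_minimalMass T).isSolutionRNLS (x₀ := x₀) hn hM0 hQ
    simp only [← minimalMass_eq_quadWave] at h
    exact h
  have hu : IsSolutionRNLS γ M univ (Rtransform γ M (minimalMass Q T x₀)) := by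
    have h := (isModulation_Rtransform hγ0 hγT).isSolutionRNLS (x₀ := x₀) hn hM hQ
    simp only [← Rtransform_minimalMass_eq_quadWave hM hγ0 hγT] at h
    exact h
  have hexp : ∀ t, Real.exp (2 * |γ| * t) = Real.exp (-(2 * γ * t)) := fun t => by
    rw [abs_of_neg hγ0]; congr 1; ring
  obtain ⟨K, hK⟩ := exists_gradNorm_Rtransform_le hn hM hT hγ0 hγT hQ x₀
  obtain ⟨κ, hκ, hle⟩ := exists_le_gradNorm_Rtransform hn hM hγ0 hγT hQ x₀
  have hlim : Tendsto (fun t => κ * Real.exp (-(2 * γ * t))) atTop atTop := by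
    refine (Real.tendsto_exp_atTop.comp ?_).const_mul_atTop hκ
    have : (fun t => -(2 * γ * t)) = fun t => -(2 * γ) * t := by funext t; ring
    rw [this]
    exact tendsto_id.const_mul_atTop (by linarith)
  refine ⟨⟨hφ, fun t ht => ?_, tendsto_gradNorm_minimalMass hn hQ⟩, hu,
    tendsto_atTop_mono' _ hle hlim, ?_, ?_⟩
  · have hw := (hφ.continuous t ht).1.memLp
    rw [minimalMass_eq_quadWave] at hw ⊢
    exact eLpNorm_quadWave (sub_pos.2 ht) (norm_matFlow hM0 t) hQ hw
  · refine IsBigO.of_bound K ?_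
    filter_upwards [eventually_ge_atTop 0] with t ht
    rw [hexp, Real.norm_of_nonneg (Real.exp_pos _).le, Real.norm_of_nonneg (gradNorm_nonneg _)]
    exact hK t ht
  · refine IsBigO.of_bound κ⁻¹ ?_
    filter_upwards [hle] with t ht
    rw [hexp, Real.norm_of_nonneg (Real.exp_pos _).le, Real.norm_of_nonneg (gradNorm_nonneg _),
      ← div_eq_inv_mul, le_div_iff₀ hκ, mul_comm]
    exact ht
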